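/- Let $V$ be a complex Hilbert space with inner product $\langle\cdot|\cdot\rangle$ (antilinear in the first slot), and let $\Omega=\operatorname{Im}\langle\cdot|\cdot\rangle$. Let $SV=\bigoplus_n S^nV$ be its symmetric algebra with the inner product for which the $S^nV$ are mutually perpendicular and $\langle x_1\cdots x_n|y_1\cdots y_n\rangle=\sum_p\prod_j\langle x_j|y_{p(j)}\rangle$, let $SV'$ be the space of all antilinear functionals $SV\to\mathbb C$, with the commutative product $[\Phi\Psi](\theta)=[\Phi\otimes\Psi](\Delta\theta)$ dual to the coproduct $\Delta$ of $SV$ (the algebra homomorphism with $\Delta v=v\otimes 1+1\otimes v$ for $v\in V$), and embed $SV\subset SV'$ by $\phi\mapsto\langle\cdot|\phi\rangle$. Fock space $S[V]\subset SV'$ consists of the bounded antifunctionals; it is the Hilbert space completion of $SV$. For $v\in V$ the creator $c(v)$ on $SV$ is multiplication by $v$ and the annihilator $a(v)$ is the linear derivation of $SV$ with $a(v)w=\langle v|w\rangle$ for $w\in V$; on $SV'$ put $[c(v)\Phi](\psi)=\Phi(a(v)\psi)$ and $[a(v)\Phi](\psi)=\Phi(c(v)\psi)$. For an antilinear operator $Z$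 of a complex Hilbert space $W$ that is symmetric ($\langle y|Zx\rangle=\langle x|Zy\rangle$), the Gaussian is $e^Z=\sum_n\frac1{n!}\zeta^n\in SW'$ (pointwise convergence on $SW$), where $\zeta\in SW'$ vanishes on $S^nW$ for $n\ne2$ and $\zeta(xy)=\langle y|Zx\rangle$. An antilinear map $U:SV\to SV'$ has kernel $u\in S(V\oplus V)'$ if $[U\phi](\psi)=u(\phi_1\psi_2)$ for all $\phi,\psi\in SV$, the indices $1,2$ denoting the maps induced by the two inclusions $V\to V\oplus V$. Let $g$ be an antisymplectic automorphism of $V$: a real-linear bijection with $\Omega(gx,gy)=-\Omega(x,y)$ for all $x,y\in V$. Put $C_g=\frac12(g-igi)$ and $A_g=\frac12(g+igi)$. A weak metaplectic operator implementing $g$ is a nonzero antilinear map $U:SV\to SV'$ such that for all $v\in V$ $$U\,c(v)=\{a(C_gv)+c(A_gv)\}\,U,\qquad U\,a(v)=\{a(A_gv)+c(C_gv)\}\,U .$$ Then: 1. $A_g$ and $A_{g^{-1}}$ are invertible, and $Z_g=A_g^{-1}C_g$ is symmetric with operator norm strictly less than $1$. 2. The antilinear operator $Z$ of $V\oplus V$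 given by $$Z(v_1)=(Z_gv)_1+(A_{g^{-1}}^{-1}v)_2,\qquad Z(v_2)=(A_g^{-1}v)_1+(Z_{g^{-1}}v)_2\qquad(v\in V)$$ has a Gaussian $e^Z\in S(V\oplus V)'$, and the antilinear map $U_g:SV\to SV'$ with kernel $e^Z$ is a weak metaplectic operator implementing $g$. 3. Every weak metaplectic operator implementing $g$ is a nonzero scalar multiple of $U_g$. 4. Some nonzero scalar multiple of $U_g$ is antiunitary (that is, maps $SV$ into $S[V]$ and extends to an antiunitary operator on $S[V]$) if and only if $C_g$ is a Hilbert–Schmidt operator. 5. $C_g$ is Hilbert–Schmidt if and only if the anticommutator $[g,i]_+=gi+ig$ is Hilbert–Schmidt; thus $g$ is implemented by an antiunitary weak metaplectic operator if and only if $[g,i]_+$ is Hilbert–Schmidt. -/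

import Mathlib

open scoped TensorProduct ComplexConjugate

noncomputable section

namespace Fock

variable {V : Type*} [NormedAddCommGroup V] [InnerProductSpace ℂ V]

/-! ### Symmetric algebra, antidual, creators and annihilators -/

/-- The symmetric algebra `SV`. -/
abbrev Sym (V : Type*) [NormedAddCommGroup V] [InnerProductSpace ℂ V] : Type _ :=
  SymmetricAlgebra ℂ V

/-- The inclusion `V → SV`. -/
abbrev inc (V : Type*) [NormedAddCommGroup V] [InnerProductSpace ℂ V] : V →ₗ[ℂ] Sym V :=
  SymmetricAlgebra.ι ℂ V

/-- The homogeneous summand `SⁿV`, spanned by the products of `n` vectors. -/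
def homog (V : Type*) [NormedAddCommGroup V] [InnerProductSpace ℂ V] (n : ℕ) :
    Submodule ℂ (Sym V) :=
  LinearMap.range (inc V) ^ n

/-- The full antidual `SV'`: all antilinear functionals on `SV`. -/
abbrev Antidual (V : Type*) [NormedAddCommGroup V] [InnerProductSpace ℂ V] : Type _ :=
  Sym V →ₗ⋆[ℂ] ℂ

/-- The algebra homomorphism `SV → SV[ε]` with `w ↦ w + ⟨v|w⟩ ε`. -/
def annihilatorHom (v : V) : Sym V →ₐ[ℂ] DualNumber (Sym V) :=
  SymmetricAlgebra.lift
    ((TrivSqZeroExt.inlAlgHom ℂ (Sym V) (Sym V)).toLinearMap ∘ₗ inc V +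
      ((TrivSqZeroExt.inrHom (Sym V) (Sym V)).restrictScalars ℂ) ∘ₗ
        (Algebra.linearMap ℂ (Sym V)) ∘ₗ (innerₛₗ ℂ v))

theorem annihilatorHom_fst (v : V) (φ : Sym V) : (annihilatorHom v φ).fst = φ := by
  have h : (TrivSqZeroExt.fstHom ℂ (Sym V) (Sym V)).comp (annihilatorHom v) =
      AlgHom.id ℂ (Sym V) := by
    apply SymmetricAlgebra.algHom_ext
    ext w
    simp [annihilatorHom]
  exact congr($h φ)

/-- The annihilator `a(v)` on `SV`: the derivation with `a(v) w = ⟨v|w⟩` for `w ∈ V`. -/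
def annih (v : V) : Derivation ℂ (Sym V) (Sym V) :=
  Derivation.mk'
    (((TrivSqZeroExt.sndHom (Sym V) (Sym V)).restrictScalars ℂ) ∘ₗ
      (annihilatorHom v).toLinearMap)
    (fun φ ψ => by
      simp [annihilatorHom_fst, mul_comm])

@[simp]
theorem annih_inc (v w : V) : annih v (inc V w) = algebraMap ℂ (Sym V) (inner ℂ v w) := by
  simp [annih, annihilatorHom, Algebra.algebraMap_eq_smul_one]

theorem derivation_ext {D E : Derivation ℂ (Sym V) (Sym V)}
    (h : ∀ w, D (inc V w) = E (inc V w)) : D = E := by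
  ext φ
  induction φ using SymmetricAlgebra.induction with
  | algebraMap r => simp
  | ι x => exact h x
  | mul a b ha hb => simp [ha, hb]
  | add a b ha hb => simp [ha, hb]

theorem annih_add (v w : V) : annih (v + w) = annih v + annih w :=
  derivation_ext fun x => by simp

theorem annih_smul (c : ℂ) (v : V) : annih (c • v) = conj c • annih v :=
  derivation_ext fun x => by simp [Algebra.smul_def, mul_comm]

theorem annih_comm (v w : V) (φ : Sym V) : annih v (annih w φ) = annih w (annih v φ) := by
  have h : ⁅annih v, annih w⁆ = (0 : Derivation ℂ (Sym V) (Sym V)) :=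
    derivation_ext fun x => by simp [Derivation.commutator_apply]
  have := congr($h φ)
  simpa [Derivation.commutator_apply, sub_eq_zero] using this

/-- The creator `c(v)` on `SV`: multiplication by `v`. -/
def creat (v : V) : Sym V →ₗ[ℂ] Sym V := LinearMap.mulLeft ℂ (inc V v)

/-- The creator `c(v)` on `SV'`: `[c(v)Φ](ψ) = Φ(a(v)ψ)`. -/
def creat' (v : V) : Antidual V →ₗ[ℂ] Antidual V where
  toFun Φ := Φ.comp (annih v).toLinearMap
  map_add' _ _ := rfl
  map_smul' _ _ := rfl

/-- The annihilator `a(v)` on `SV'`: `[a(v)Φ](ψ) = Φ(c(v)ψ)`. -/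
def annih' (v : V) : Antidual V →ₗ[ℂ] Antidual V where
  toFun Φ := Φ.comp (creat v)
  map_add' _ _ := rfl
  map_smul' _ _ := rfl

@[simp]
theorem creat'_apply (v : V) (Φ : Antidual V) (ψ : Sym V) : creat' v Φ ψ = Φ (annih v ψ) := rfl

/-! ### The commutative product of the antidual, quadratics and Gaussians -/

/-- The antifunctional `Φ ⊗ Ψ` on `SV ⊗ SV`. -/
def tensorAnti (Φ Ψ : Antidual V) : (Sym V ⊗[ℂ] Sym V) →ₗ⋆[ℂ] ℂ :=
  TensorProduct.lift (LinearMap.mk₂'ₛₗ (starRingEnd ℂ) (starRingEnd ℂ)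
    (fun φ ψ => Φ φ * Ψ ψ)
    (fun _ _ _ => by simp [add_mul]) (fun _ _ _ => by simp [mul_assoc])
    (fun _ _ _ => by simp [mul_add]) (fun _ _ _ => by simp [mul_left_comm]))

/-- The product of `SV'`: `[ΦΨ](θ) = [Φ ⊗ Ψ](Δθ)`. -/
def mulAnti (Φ Ψ : Antidual V) : Antidual V :=
  (tensorAnti Φ Ψ).comp (Coalgebra.comul (R := ℂ) (A := Sym V))

/-- The unit of `SV'`: the conjugate of the projection `SV → S⁰V = ℂ`. -/
def oneAnti : Antidual V where
  toFun θ := conj (Coalgebra.counit (R := ℂ) θ)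
  map_add' _ _ := by simp
  map_smul' _ _ := by simp

/-- The powers of an element of `SV'`. -/
def powAnti (Φ : Antidual V) : ℕ → Antidual V
  | 0 => oneAnti
  | n + 1 => mulAnti Φ (powAnti Φ n)

/-- `ζ ∈ SV'` is a quadratic: it is concentrated in second degree. -/
def IsQuadratic (ζ : Antidual V) : Prop :=
  ∀ n, n ≠ 2 → ∀ θ ∈ homog V n, ζ θ = 0

/-- `u = e^Z = ∑ ζⁿ / n!` pointwise on `SV`, where `ζ` is the quadratic that corresponds to the
antilinear operator `Z`, that is `ζ(xy) = ⟨y|Zx⟩`.  (Such a `ζ` is unique, and it exists only if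
`Z` is symmetric.) -/
def IsGaussian (Z : V →ₗ⋆[ℂ] V) (u : Antidual V) : Prop :=
  ∃ ζ : Antidual V, IsQuadratic ζ ∧
    (∀ x y, ζ (inc V x * inc V y) = inner ℂ y (Z x)) ∧
    ∀ θ, HasSum (fun n : ℕ => ((n.factorial : ℂ))⁻¹ * powAnti ζ n θ) (u θ)

/-! ### The canonical inner product of `SV` and Fock space -/

theorem creat'_comm (v w : V) : creat' v * creat' w = creat' w * creat' v := by
  ext Φ ψ
  simp [annih_comm]

/-- The commutative algebra of operators on `SV'` generated by the creators. -/
def creatorAlgebra (V : Type*) [NormedAddCommGroup V] [InnerProductSpace ℂ V] :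
    Subalgebra ℂ (Module.End ℂ (Antidual V)) :=
  Algebra.adjoin ℂ (Set.range creat')

instance creatorAlgebra.instCommRing : CommRing (creatorAlgebra V) :=
  { (creatorAlgebra V).toRing with
    mul_comm := (Algebra.isMulCommutative_adjoin ℂ (by
      rintro _ ⟨v, rfl⟩ _ ⟨w, rfl⟩
      exact creat'_comm v w)).is_comm.comm }

/-- The creators of `SV'`, as a linear map on `V`. -/
def creatorLin : V →ₗ[ℂ] creatorAlgebra V where
  toFun v := ⟨creat' v, Algebra.subset_adjoin ⟨v, rfl⟩⟩
  map_add' v w := by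
    ext Φ ψ
    simp [annih_add]
  map_smul' c v := by
    ext Φ ψ
    simp [annih_smul]

/-- The algebra homomorphism from `SV` to the operators on `SV'` with `v ↦ c(v)`. -/
def creatorHom : Sym V →ₐ[ℂ] creatorAlgebra V := SymmetricAlgebra.lift creatorLin

/-- The canonical embedding `SV → SV'`, `φ ↦ ⟨·|φ⟩`: the product `v₁ ⋯ vₙ` is mapped to
`c(v₁) ⋯ c(vₙ) 1`. -/
def embed : Sym V →ₗ[ℂ] Antidual V where
  toFun φ := (creatorHom φ : Module.End ℂ (Antidual V)) oneAnti
  map_add' _ _ := by simp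
  map_smul' _ _ := by simp

/-- The canonical inner product `⟨ψ|φ⟩` of `SV`. -/
def innerS (ψ φ : Sym V) : ℂ := embed φ ψ

theorem innerS_one (ψ : Sym V) : innerS ψ 1 = conj (Coalgebra.counit (R := ℂ) ψ) := by
  simp [innerS, embed, oneAnti]

theorem innerS_inc_mul (v : V) (ψ φ : Sym V) :
    innerS ψ (inc V v * φ) = innerS (annih v ψ) φ := by
  simp [innerS, embed, creatorHom, creatorLin]

theorem annih_prod {n : ℕ} (v : V) (x : Fin (n + 1) → V) :
    annih v (∏ i, inc V (x i)) =
      ∑ i, inner ℂ v (x i) • ∏ j : Fin n, inc V (x (Equiv.swap 0 i j.succ)) := by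
  have key : ∀ s : Finset (Fin (n + 1)), annih v (∏ i ∈ s, inc V (x i)) =
      ∑ i ∈ s, inner ℂ v (x i) • ∏ j ∈ s.erase i, inc V (x j) := by
    intro s
    induction s using Finset.induction_on with
    | empty => simp
    | insert a s ha ih =>
      rw [Finset.prod_insert ha, Derivation.leibniz, ih, Finset.sum_insert ha,
        Finset.erase_insert ha, annih_inc, add_comm]
      congr 1
      · rw [smul_eq_mul, mul_comm, Algebra.smul_def]
      · rw [Finset.smul_sum]
        refine Finset.sum_congr rfl fun i hi => ?_
        have hne : a ≠ i := fun h => ha (h ▸ hi)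
        rw [Finset.erase_insert_of_ne hne, Finset.prod_insert (by simp [ha]), smul_eq_mul,
          mul_smul_comm]
  rw [key]
  refine Finset.sum_congr rfl fun i _ => ?_
  congr 1
  symm
  refine Finset.prod_bij (fun j _ => Equiv.swap 0 i j.succ) ?_ ?_ ?_ ?_
  · intro j _
    simp only [Finset.mem_erase, Finset.mem_univ, and_true]
    intro h
    have := congrArg (Equiv.swap 0 i) h
    simp at this
  · intro j _ k _ h
    simpa using h
  · intro k hk
    have hk' : Equiv.swap 0 i k ≠ 0 := by
      intro h
      have := congrArg (Equiv.swap 0 i) h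
      simp at this
      simp [this] at hk
    obtain ⟨j, hj⟩ := Fin.exists_succ_eq.2 hk'
    exact ⟨j, Finset.mem_univ _, by simp [hj]⟩
  · intro j _
    rfl

theorem innerS_sum_smul {ι : Type*} (s : Finset ι) (c : ι → ℂ) (f : ι → Sym V) (φ : Sym V) :
    innerS (∑ i ∈ s, c i • f i) φ = ∑ i ∈ s, conj (c i) * innerS (f i) φ := by
  simp [innerS]

/-- The defining formula of the canonical inner product on products of `n` vectors. -/
theorem innerS_prod {n : ℕ} (x y : Fin n → V) :
    innerS (∏ i, inc V (x i)) (∏ i, inc V (y i)) =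
      ∑ p : Equiv.Perm (Fin n), ∏ j, inner ℂ (x j) (y (p j)) := by
  have key : ∀ (n : ℕ) (x y : Fin n → V),
      innerS (∏ i, inc V (x i)) (∏ i, inc V (y i)) =
        ∑ p : Equiv.Perm (Fin n), ∏ j, inner ℂ (x (p j)) (y j) := by
    intro n
    induction n with
    | zero => intro x y; simp [innerS_one]
    | succ n ih =>
      intro x y
      rw [Fin.prod_univ_succ (fun i => inc V (y i)), innerS_inc_mul, annih_prod,
        innerS_sum_smul, ← Equiv.sum_comp Equiv.Perm.decomposeFin.symm, Fintype.sum_prod_type]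
      refine Finset.sum_congr rfl fun i _ => ?_
      rw [ih, Finset.mul_sum]
      refine Finset.sum_congr rfl fun p _ => ?_
      rw [Fin.prod_univ_succ]
      simp
  rw [key, ← Equiv.sum_comp (Equiv.inv _)]
  refine Finset.sum_congr rfl fun p _ => ?_
  rw [← Equiv.prod_comp p]
  simp

/-- Products of different degrees are perpendicular. -/
theorem innerS_prod_of_ne {m n : ℕ} (h : m ≠ n) (x : Fin m → V) (y : Fin n → V) :
    innerS (∏ i, inc V (x i)) (∏ i, inc V (y i)) = 0 := by
  induction n generalizing m with
  | zero =>
    obtain ⟨m, rfl⟩ := Nat.exists_eq_succ_of_ne_zero h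
    simp [innerS_one, Fin.prod_univ_succ]
  | succ n ih =>
    rw [Fin.prod_univ_succ (fun i => inc V (y i)), innerS_inc_mul]
    cases m with
    | zero => simp [innerS]
    | succ m =>
      rw [annih_prod, innerS_sum_smul]
      exact Finset.sum_eq_zero fun i _ => by rw [ih (by omega), mul_zero]

/-- `‖Φ(ψ)‖ ≤ M ‖ψ‖` for all `ψ ∈ SV`. -/
def BoundedBy (Φ : Antidual V) (M : ℝ) : Prop :=
  0 ≤ M ∧ ∀ ψ, ‖Φ ψ‖ ≤ M * √(innerS ψ ψ).re

/-- Bosonic Fock space `S[V]`: the subspace of `SV'` of all bounded antifunctionals. -/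
def fockSpace (V : Type*) [NormedAddCommGroup V] [InnerProductSpace ℂ V] :
    Submodule ℂ (Antidual V) where
  carrier := {Φ | ∃ M, BoundedBy Φ M}
  add_mem' := by
    rintro Φ Ψ ⟨M, hM, h⟩ ⟨N, hN, k⟩
    refine ⟨M + N, add_nonneg hM hN, fun ψ => ?_⟩
    rw [add_mul]
    exact (norm_add_le _ _).trans (add_le_add (h ψ) (k ψ))
  zero_mem' := ⟨0, le_rfl, fun ψ => by simp⟩
  smul_mem' := by
    rintro c Φ ⟨M, hM, h⟩
    refine ⟨‖c‖ * M, by positivity, fun ψ => ?_⟩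
    rw [LinearMap.smul_apply, norm_smul, mul_assoc]
    exact mul_le_mul_of_nonneg_left (h ψ) (norm_nonneg _)

/-- The Hilbert space norm of Fock space: the least bound of the antifunctional. -/
def fockNorm (Φ : fockSpace V) : ℝ := sInf {M | BoundedBy (Φ : Antidual V) M}

/-- The antilinear map `U : SV → SV'` is antiunitary on Fock space: it takes values in `S[V]` and
extends to an antiunitary operator of `S[V]`, that is, to a bijective antilinear isometry. -/
def IsAntiunitary (U : Sym V →ₗ⋆[ℂ] Antidual V) : Prop :=
  ∃ W : fockSpace V →ₗ⋆[ℂ] fockSpace V,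
    Function.Bijective W ∧ (∀ Φ, fockNorm (W Φ) = fockNorm Φ) ∧
    ∀ φ : Sym V, ∃ h : embed φ ∈ fockSpace V, (W ⟨embed φ, h⟩ : Antidual V) = U φ

/-! ### Kernels of antilinear maps `SV → SV'` -/

/-- The Hilbert space direct sum `V ⊕ V`. -/
abbrev Double (V : Type*) [NormedAddCommGroup V] [InnerProductSpace ℂ V] : Type _ :=
  WithLp 2 (V × V)

/-- The first inclusion `v ↦ v₁` of `V` in `V ⊕ V`. -/
def inc₁ : V →ₗ[ℂ] Double V :=
  (WithLp.linearEquiv 2 ℂ (V × V)).symm.toLinearMap ∘ₗ LinearMap.inl ℂ V V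

/-- The second inclusion `v ↦ v₂` of `V` in `V ⊕ V`. -/
def inc₂ : V →ₗ[ℂ] Double V :=
  (WithLp.linearEquiv 2 ℂ (V × V)).symm.toLinearMap ∘ₗ LinearMap.inr ℂ V V

/-- The algebra homomorphism `φ ↦ φ₁` from `SV` to `S(V ⊕ V)`. -/
def sym₁ : Sym V →ₐ[ℂ] Sym (Double V) := SymmetricAlgebra.lift (inc (Double V) ∘ₗ inc₁)

/-- The algebra homomorphism `ψ ↦ ψ₂` from `SV` to `S(V ⊕ V)`. -/
def sym₂ : Sym V →ₐ[ℂ] Sym (Double V) := SymmetricAlgebra.lift (inc (Double V) ∘ₗ inc₂)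

/-- The antilinear map `U : SV → SV'` with kernel `u`: `[Uφ](ψ) = u(φ₁ψ₂)`. -/
def kernelOp (u : Antidual (Double V)) : Sym V →ₗ⋆[ℂ] Antidual V :=
  LinearMap.mk₂'ₛₗ (starRingEnd ℂ) (starRingEnd ℂ) (fun φ ψ => u (sym₁ φ * sym₂ ψ))
    (fun _ _ _ => by simp [add_mul]) (fun _ _ _ => by simp)
    (fun _ _ _ => by simp [mul_add]) (fun _ _ _ => by simp)

/-! ### Antisymplectic automorphisms and their metaplectic operators -/

/-- `Ω(gx, gy) = -Ω(x, y)` for the real symplectic form `Ω = Im ⟨·|·⟩`. -/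
def IsAntisymplectic (g : V ≃ₗ[ℝ] V) : Prop :=
  ∀ x y, (inner ℂ (g x) (g y)).im = -(inner ℂ x y).im

theorem map_smul_complex (g : V ≃ₗ[ℝ] V) (c : ℂ) (v : V) :
    g (c • v) = (c.re : ℂ) • g v + (c.im : ℂ) • g (Complex.I • v) := by
  conv_lhs => rw [← Complex.re_add_im c, add_smul, mul_smul, map_add]
  simp only [Complex.coe_smul, map_smul]

theorem map_I_smul_complex (g : V ≃ₗ[ℝ] V) (c : ℂ) (v : V) :
    g (Complex.I • c • v) = (c.re : ℂ) • g (Complex.I • v) - (c.im : ℂ) • g v := by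
  rw [smul_smul, map_smul_complex g]
  simp [sub_eq_add_neg, add_comm]

/-- The complex-linear part `C_g = (g - i g i) / 2`. -/
def linPart (g : V ≃ₗ[ℝ] V) : V →ₗ[ℂ] V where
  toFun v := (2⁻¹ : ℂ) • (g v - Complex.I • g (Complex.I • v))
  map_add' v w := by simp only [smul_add, map_add]; module
  map_smul' c v := by
    rw [map_I_smul_complex, map_smul_complex g c, RingHom.id_apply]
    rw [show c • (2⁻¹ : ℂ) • (g v - Complex.I • g (Complex.I • v)) =
      ((c.re : ℂ) + c.im * Complex.I) • (2⁻¹ : ℂ) • (g v - Complex.I • g (Complex.I • v)) by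
        rw [Complex.re_add_im]]
    match_scalars
    · ring
    · linear_combination (2⁻¹ * (c.im : ℂ)) * Complex.I_sq

/-- The antilinear part `A_g = (g + i g i) / 2`. -/
def antiPart (g : V ≃ₗ[ℝ] V) : V →ₗ⋆[ℂ] V where
  toFun v := (2⁻¹ : ℂ) • (g v + Complex.I • g (Complex.I • v))
  map_add' v w := by simp only [smul_add, map_add]; module
  map_smul' c v := by
    have hc : conj c = (c.re : ℂ) - c.im * Complex.I := by
      apply Complex.ext <;> simp
    rw [map_I_smul_complex, map_smul_complex, hc]
    match_scalars
    · ring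
    · linear_combination (2⁻¹ * (c.im : ℂ)) * Complex.I_sq

/-- The anticommutator `[g, i]₊ = g i + i g`, a complex-linear operator. -/
def anticomm (g : V ≃ₗ[ℝ] V) : V →ₗ[ℂ] V where
  toFun v := g (Complex.I • v) + Complex.I • g v
  map_add' v w := by simp only [smul_add, map_add]; module
  map_smul' c v := by
    rw [map_I_smul_complex, map_smul_complex g c, RingHom.id_apply]
    rw [show c • (g (Complex.I • v) + Complex.I • g v) =
      ((c.re : ℂ) + c.im * Complex.I) • (g (Complex.I • v) + Complex.I • g v) by
        rw [Complex.re_add_im]]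
    match_scalars
    · ring
    · linear_combination -(c.im : ℂ) * Complex.I_sq

/-- The inverse of an antilinear operator (only meaningful, and only used, for bijections). -/
def antiInv (A : V →ₗ⋆[ℂ] V) : V →ₗ⋆[ℂ] V :=
  open Classical in
  if h : Function.Bijective A then (LinearEquiv.ofBijective A h).symm.toLinearMap else 0

/-- The antilinear operator `Z_g = A_g⁻¹ C_g`. -/
def zPart (g : V ≃ₗ[ℝ] V) : V →ₗ⋆[ℂ] V := (antiInv (antiPart g)).comp (linPart g)

/-- The antilinear operator `Z` of `V ⊕ V` with
`Z(v₁) = (Z_g v)₁ + (A_{g⁻¹}⁻¹ v)₂` and `Z(v₂) = (A_g⁻¹ v)₁ + (Z_{g⁻¹} v)₂`. -/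
def kernelZ (g : V ≃ₗ[ℝ] V) : Double V →ₗ⋆[ℂ] Double V where
  toFun w :=
    (inc₁ (zPart g w.fst) + inc₂ (antiInv (antiPart g.symm) w.fst)) +
    (inc₁ (antiInv (antiPart g) w.snd) + inc₂ (zPart g.symm w.snd))
  map_add' v w := by simp only [WithLp.add_fst, WithLp.add_snd, map_add]; abel
  map_smul' c v := by
    simp only [WithLp.smul_fst, WithLp.smul_snd, map_smulₛₗ, RingHom.id_apply, smul_add]

/-- `U` is a weak metaplectic operator implementing the antisymplectic `g`: a nonzero antilinear
map `SV → SV'` with `U c(v) = {a(C_g v) + c(A_g v)} U` and `U a(v) = {a(A_g v) + c(C_g v)} U`. -/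
def IsWeakMetaplectic (g : V ≃ₗ[ℝ] V) (U : Sym V →ₗ⋆[ℂ] Antidual V) : Prop :=
  U ≠ 0 ∧
  (∀ v φ, U (creat v φ) = annih' (linPart g v) (U φ) + creat' (antiPart g v) (U φ)) ∧
  (∀ v φ, U (annih v φ) = annih' (antiPart g v) (U φ) + creat' (linPart g v) (U φ))

/-- The antilinear operator `Z` is symmetric: `⟨y|Zx⟩ = ⟨x|Zy⟩`. -/
def IsSymmetricAnti (Z : V →ₗ⋆[ℂ] V) : Prop :=
  ∀ x y, inner ℂ y (Z x) = inner ℂ x (Z y)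

/-- `T` is a Hilbert-Schmidt operator: it is bounded, and `∑ ‖T eₖ‖² < ∞` for an orthonormal
Hilbert basis `(eₖ)`. -/
def IsHilbertSchmidt (T : V →ₗ[ℂ] V) : Prop :=
  Continuous T ∧ ∃ (w : Set V) (b : HilbertBasis w ℂ V), Summable fun k => ‖T (b k)‖ ^ 2

end Fock

end

open scoped TensorProduct ComplexConjugate

noncomputable section

namespace Fock

variable {V : Type*} [NormedAddCommGroup V] [InnerProductSpace ℂ V]

/-! ### Induction and grading on the symmetric algebra -/

/-! The polarized identities between g and its inverse give everything about V. Relative to Ω the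
adjoint of g is minus its inverse; splitting into complex-linear and antilinear parts, C_g has
adjoint -C_{g⁻¹} and A_g has adjoint A_{g⁻¹}. Combined with g⁻¹g = 1 this yields ‖A_g v‖² = ‖v‖² +
‖C_g v‖² (`norm_antiPart_sq`), so A_g is bounded below, as is its adjoint; g is bounded by the
closed graph theorem, and invertibility and ‖Z_g‖ < 1 follow.

On the symmetric algebra a Gaussian is handled through its recursion u(vψ) = u(a(Zv)ψ) with u(1) =
1, which lowers the degree by two. Existence comes from the commuting operators c(v) + a(Zv), and
the exponential series satisfies the same recursion. For the operator Z on V ⊕ V the recursion says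
how the kernel operator U moves a vector from either argument (`IsKernelLike`), and the identities
among A, C and Z turn this into the two intertwining relations. Conversely these relations determine
U from the number U(1)(1): the annihilator relation fixes the vacuum image U(1), the creator
relation the rest. Hence uniqueness up to scale.

The vacuum image U_g(1) is the Gaussian of Z_{g⁻¹}. If it lies in Fock space, testing it on ∑ e_k ·
Z e_k bounds the Hilbert–Schmidt norm of Z_{g⁻¹}, hence of C_{g⁻¹} = A_{g⁻¹}Z_{g⁻¹} and of its
adjoint -C_g. If C_g is Hilbert–Schmidt, a recursion for the norms of the homogeneous parts shows
that the Gaussian is in Fock space, even after a dilation t^N with t > 1 (N the number operator).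
This margin (`Reg`) survives creators and annihilators and makes them mutually adjoint on the range
of U, so the intertwining relations force U to be a multiple of an isometry. The same holds for the
transposed operator, which belongs to g⁻¹; the two are adjoint to each other, so the range is dense
and a rescaling is antiunitary. -/

theorem sym_induction {P : Sym V → Prop} (one : P 1) (smul : ∀ (c : ℂ) θ, P θ → P (c • θ))
    (add : ∀ θ η, P θ → P η → P (θ + η)) (cons : ∀ v θ, P θ → P (inc V v * θ)) (θ : Sym V) :
    P θ := by
  suffices h : ∀ η, P η → P (θ * η) by simpa using h 1 one
  induction θ using SymmetricAlgebra.induction with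
  | algebraMap r => intro η hη; rw [← Algebra.smul_def]; exact smul r η hη
  | ι x => exact cons x
  | mul a b ha hb => intro η hη; rw [mul_assoc]; exact ha _ (hb _ hη)
  | add a b ha hb => intro η hη; rw [add_mul]; exact add _ _ (ha _ hη) (hb _ hη)

theorem one_mem_homog : (1 : Sym V) ∈ homog V 0 := by
  rw [homog, pow_zero]; exact Submodule.one_le.1 le_rfl

theorem inc_mul_mem_homog {n : ℕ} (v : V) {ψ : Sym V} (h : ψ ∈ homog V n) :
    inc V v * ψ ∈ homog V (n + 1) := by
  rw [homog, pow_succ']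
  exact Submodule.mul_mem_mul ⟨v, rfl⟩ h

theorem homog_zero_induction {P : Sym V → Prop} (one : P 1) (smul : ∀ (c : ℂ) θ, P θ → P (c • θ))
    {θ : Sym V} (hθ : θ ∈ homog V 0) : P θ := by
  rw [homog, pow_zero] at hθ
  obtain ⟨c, rfl⟩ := Submodule.mem_one.1 hθ
  rw [Algebra.algebraMap_eq_smul_one]
  exact smul c 1 one

theorem homog_succ_induction {n : ℕ} {P : Sym V → Prop}
    (add : ∀ θ η, P θ → P η → P (θ + η)) (cons : ∀ v, ∀ θ ∈ homog V n, P (inc V v * θ))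
    {θ : Sym V} (hθ : θ ∈ homog V (n + 1)) : P θ := by
  rw [homog, pow_succ'] at hθ
  refine Submodule.mul_induction_on hθ ?_ add
  rintro _ ⟨v, rfl⟩ η hη
  exact cons v η hη

/-- The algebra homomorphism `SV → SV[X]` with `v ↦ vX`. -/
def degreeHom (V : Type*) [NormedAddCommGroup V] [InnerProductSpace ℂ V] :
    Sym V →ₐ[ℂ] Polynomial (Sym V) :=
  SymmetricAlgebra.lift
    (((LinearMap.mulRight (Sym V) (Polynomial.X : Polynomial (Sym V))).restrictScalars ℂ) ∘ₗ
      (Polynomial.CAlgHom (R := ℂ) (A := Sym V)).toLinearMap ∘ₗ inc V)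

@[simp]
theorem degreeHom_inc (v : V) : degreeHom V (inc V v) = Polynomial.C (inc V v) * Polynomial.X := by
  simp [degreeHom]

/-- The projection of `SV` on `SⁿV`. -/
def homProj (n : ℕ) : Sym V →ₗ[ℂ] Sym V :=
  ((Polynomial.lcoeff (Sym V) n).restrictScalars ℂ) ∘ₗ (degreeHom V).toLinearMap

theorem homProj_apply (n : ℕ) (θ : Sym V) : homProj n θ = (degreeHom V θ).coeff n := rfl

theorem degreeHom_of_mem {n : ℕ} {θ : Sym V} (hθ : θ ∈ homog V n) :
    degreeHom V θ = Polynomial.C θ * Polynomial.X ^ n := by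
  induction n generalizing θ with
  | zero =>
    refine homog_zero_induction
      (P := fun θ => degreeHom V θ = Polynomial.C θ * Polynomial.X ^ 0) (by simp)
      (fun c θ h => ?_) hθ
    rw [map_smul, h, pow_zero, mul_one, mul_one, Polynomial.smul_C]
  | succ n ih =>
    refine homog_succ_induction
      (P := fun θ => degreeHom V θ = Polynomial.C θ * Polynomial.X ^ (n + 1))
      (fun θ η h k => ?_) (fun v θ h => ?_) hθ
    · rw [map_add, h, k, map_add, add_mul]
    · rw [map_mul, ih h, degreeHom_inc, map_mul]; ring

theorem homProj_of_mem {n : ℕ} {θ : Sym V} (hθ : θ ∈ homog V n) : homProj n θ = θ := by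
  simp [homProj_apply, degreeHom_of_mem hθ]

theorem homProj_of_mem_ne {m n : ℕ} {θ : Sym V} (hθ : θ ∈ homog V n) (h : m ≠ n) :
    homProj m θ = 0 := by
  rw [homProj_apply, degreeHom_of_mem hθ, Polynomial.coeff_C_mul_X_pow, if_neg h]

theorem homProj_mem (n : ℕ) (θ : Sym V) : homProj n θ ∈ homog V n := by
  induction θ using sym_induction generalizing n with
  | one =>
    by_cases h : n = 0
    · subst h; rw [homProj_of_mem one_mem_homog]; exact one_mem_homog
    · rw [homProj_of_mem_ne one_mem_homog h]; exact Submodule.zero_mem _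
  | smul c θ h => rw [map_smul]; exact Submodule.smul_mem _ _ (h n)
  | add θ η h k => rw [map_add]; exact Submodule.add_mem _ (h n) (k n)
  | cons v θ h =>
    rw [homProj_apply, map_mul, degreeHom_inc, mul_assoc, Polynomial.coeff_C_mul]
    cases n with
    | zero => simp
    | succ n => rw [Polynomial.coeff_X_mul]; exact inc_mul_mem_homog v (h n)

theorem sum_homProj (θ : Sym V) :
    ∃ N, ∑ n ∈ Finset.range N, homProj n θ = θ := by
  -- Setting X = 1 in the degree polynomial gives back the element, so the coefficients sum to it.
  have h : ((Polynomial.aeval (R := Sym V) (1 : Sym V)).restrictScalars ℂ).comp (degreeHom V) =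
      AlgHom.id ℂ (Sym V) := by
    apply SymmetricAlgebra.algHom_ext
    ext w
    simp
  refine ⟨(degreeHom V θ).natDegree + 1, ?_⟩
  have := congr($h θ)
  simp only [AlgHom.coe_comp, Function.comp_apply, AlgHom.restrictScalars_apply,
    Polynomial.aeval_eq_sum_range, one_pow, AlgHom.id_apply] at this
  simpa [homProj_apply] using this

theorem of_homog {P : Sym V → Prop} (zero : P 0) (add : ∀ θ η, P θ → P η → P (θ + η))
    (h : ∀ n, ∀ θ ∈ homog V n, P θ) (θ : Sym V) : P θ := by
  obtain ⟨N, hN⟩ := sum_homProj θ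
  rw [← hN]
  exact Finset.sum_induction _ P add zero fun n _ => h n _ (homProj_mem n θ)

/-- Adapted to recursions that trade multiplication by a vector for an annihilator: the hypothesis
is available in all degrees up to n, because the annihilator lands in degree n - 1. -/
theorem degree_induction {P : Sym V → Prop} (one : P 1) (smul : ∀ (c : ℂ) θ, P θ → P (c • θ))
    (add : ∀ θ η, P θ → P η → P (θ + η))
    (cons : ∀ n v, ∀ ψ ∈ homog V n, (∀ m ≤ n, ∀ θ ∈ homog V m, P θ) → P (inc V v * ψ))
    (θ : Sym V) : P θ := by
  refine of_homog (by simpa using smul 0 1 one) add (fun n => ?_) θ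
  induction n using Nat.strong_induction_on with
  | _ n ih =>
    cases n with
    | zero => exact fun θ hθ => homog_zero_induction one smul hθ
    | succ n =>
      exact fun θ hθ => homog_succ_induction add
        (fun v ψ hψ => cons n v ψ hψ fun m hm => ih m (by omega)) hθ

/-! ### Annihilators on the graded pieces -/

theorem annih_inc_mul (v w : V) (ψ : Sym V) :
    annih v (inc V w * ψ) = inner ℂ v w • ψ + inc V w * annih v ψ := by
  rw [Derivation.leibniz, annih_inc, smul_eq_mul, smul_eq_mul, Algebra.smul_def]
  ring

theorem annih_homog_zero (v : V) {ψ : Sym V} (h : ψ ∈ homog V 0) : annih v ψ = 0 :=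
  homog_zero_induction (P := fun ψ => annih v ψ = 0) (by simp)
    (fun c θ h => by rw [Derivation.map_smul, h, smul_zero]) h

theorem annih_mem_homog {n : ℕ} (v : V) {ψ : Sym V} (h : ψ ∈ homog V (n + 1)) :
    annih v ψ ∈ homog V n := by
  induction n generalizing ψ with
  | zero =>
    refine homog_succ_induction (P := fun ψ => annih v ψ ∈ homog V 0) (fun θ η h k => ?_)
      (fun w θ hθ => ?_) h
    · rw [map_add]; exact Submodule.add_mem _ h k
    · rw [annih_inc_mul, annih_homog_zero v hθ, mul_zero, add_zero]
      exact Submodule.smul_mem _ _ hθ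
  | succ n ih =>
    refine homog_succ_induction (P := fun ψ => annih v ψ ∈ homog V (n + 1)) (fun θ η h k => ?_)
      (fun w θ hθ => ?_) h
    · rw [map_add]; exact Submodule.add_mem _ h k
    · rw [annih_inc_mul]
      exact Submodule.add_mem _ (Submodule.smul_mem _ _ hθ) (inc_mul_mem_homog w (ih hθ))

theorem annih_of_le {P : Sym V → Prop} (zero : P 0) {n : ℕ}
    (h : ∀ m ≤ n, ∀ θ ∈ homog V m, P θ) (v : V) {ψ : Sym V} (hψ : ψ ∈ homog V n) :
    P (annih v ψ) := by
  cases n with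
  | zero => rw [annih_homog_zero v hψ]; exact zero
  | succ n => exact h n (by omega) _ (annih_mem_homog v hψ)

/-- An antifunctional is determined by its value at `1` and a relation `Φ(vψ) = Φ(a(Tv)ψ)`. -/
theorem antidual_eq_zero (T : V → V) (Φ : Antidual V) (one : Φ 1 = 0)
    (h : ∀ v ψ, Φ (inc V v * ψ) = Φ (annih (T v) ψ)) : Φ = 0 := by
  ext θ
  change Φ θ = 0
  induction θ using degree_induction with
  | one => exact one
  | smul c θ h => rw [map_smulₛₗ, h, smul_zero]
  | add θ η h k => rw [map_add, h, k, add_zero]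
  | cons n v ψ hψ ih =>
    rw [h]
    exact annih_of_le (P := fun θ => Φ θ = 0) (map_zero _) ih _ hψ

/-! ### Functoriality -/

section map

variable {W : Type*} [NormedAddCommGroup W] [InnerProductSpace ℂ W]

/-- The homomorphism `SW → SV` induced by a linear map `W → V`. -/
def symMap (j : W →ₗ[ℂ] V) : Sym W →ₐ[ℂ] Sym V := SymmetricAlgebra.lift (inc V ∘ₗ j)

@[simp]
theorem symMap_inc (j : W →ₗ[ℂ] V) (w : W) : symMap j (inc W w) = inc V (j w) := by
  simp [symMap]

theorem counit_symMap (j : W →ₗ[ℂ] V) (θ : Sym W) :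
    Coalgebra.counit (R := ℂ) (symMap j θ) = Coalgebra.counit (R := ℂ) θ := by
  have h : (Bialgebra.counitAlgHom ℂ (Sym V)).comp (symMap j) =
      Bialgebra.counitAlgHom ℂ (Sym W) := by
    apply SymmetricAlgebra.algHom_ext
    ext w
    simp [SymmetricAlgebra.algebraMapInv_ι]
  exact congr($h θ)

/-- With p the adjoint of j, both sides obey the same Leibniz rule in ψ and agree on vectors. -/
theorem annih_symMap (j : W →ₗ[ℂ] V) {p : V → W} (h : ∀ v w, inner ℂ v (j w) = inner ℂ (p v) w)
    (v : V) (ψ : Sym W) : annih v (symMap j ψ) = symMap j (annih (p v) ψ) := by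
  induction ψ using sym_induction with
  | one => simp
  | smul c θ h => simp only [map_smul, Derivation.map_smul, h]
  | add θ η h k => simp only [map_add, h, k]
  | cons w θ ih => simp only [map_mul, symMap_inc, annih_inc_mul, map_add, map_smul, ih, h]

theorem innerS_add_right (ψ φ χ : Sym V) : innerS ψ (φ + χ) = innerS ψ φ + innerS ψ χ := by
  simp [innerS]

theorem innerS_smul_right (c : ℂ) (ψ φ : Sym V) : innerS ψ (c • φ) = c * innerS ψ φ := by
  simp [innerS]

theorem innerS_add_left (ψ φ χ : Sym V) : innerS (ψ + φ) χ = innerS ψ χ + innerS φ χ := by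
  simp [innerS]

theorem innerS_smul_left (c : ℂ) (ψ φ : Sym V) : innerS (c • ψ) φ = conj c * innerS ψ φ := by
  simp [innerS]

theorem innerS_symMap (j : W →ₗ[ℂ] V) (p : V →ₗ[ℂ] W)
    (h : ∀ v w, inner ℂ v (j w) = inner ℂ (p v) w) (ψ : Sym W) (φ : Sym V) :
    innerS (symMap j ψ) φ = innerS ψ (symMap p φ) := by
  induction φ using sym_induction generalizing ψ with
  | one => simp [innerS_one, counit_symMap]
  | smul c θ h => rw [innerS_smul_right, h, map_smul, innerS_smul_right]
  | add θ η h k => rw [innerS_add_right, h, k, map_add, innerS_add_right]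
  | cons w θ ih =>
    rw [innerS_inc_mul, annih_symMap j h, ih, map_mul, symMap_inc, innerS_inc_mul]

theorem symMap_comp_apply {X : Type*} [NormedAddCommGroup X] [InnerProductSpace ℂ X]
    (j : W →ₗ[ℂ] V) (k : X →ₗ[ℂ] W) (θ : Sym X) :
    symMap j (symMap k θ) = symMap (j ∘ₗ k) θ := by
  have h : (symMap j).comp (symMap k) = symMap (j ∘ₗ k) := by
    apply SymmetricAlgebra.algHom_ext
    ext w
    simp
  exact congr($h θ)

theorem symMap_id (θ : Sym V) : symMap LinearMap.id θ = θ := by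
  have h : symMap (LinearMap.id : V →ₗ[ℂ] V) = AlgHom.id ℂ _ := by
    apply SymmetricAlgebra.algHom_ext
    ext w
    simp
  exact congr($h θ)

theorem sym₁_eq : (sym₁ : Sym V →ₐ[ℂ] _) = symMap inc₁ := rfl

theorem sym₂_eq : (sym₂ : Sym V →ₐ[ℂ] _) = symMap inc₂ := rfl

end map

/-- Every element of `SV` comes from the symmetric algebra of a finite-dimensional subspace. -/
theorem exists_finiteDimensional (θ : Sym V) :
    ∃ F : Submodule ℂ V, FiniteDimensional ℂ F ∧ ∃ η : Sym F, symMap F.subtype η = θ := by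
  have mono : ∀ {F G : Submodule ℂ V} (h : F ≤ G) (η : Sym F),
      symMap G.subtype (symMap (Submodule.inclusion h) η) = symMap F.subtype η := by
    intro F G h η
    rw [symMap_comp_apply]
    rfl
  induction θ using SymmetricAlgebra.induction with
  | algebraMap r => exact ⟨⊥, inferInstance, algebraMap ℂ _ r, by simp⟩
  | ι x =>
    exact ⟨ℂ ∙ x, inferInstance, inc _ ⟨x, Submodule.mem_span_singleton_self x⟩, by simp⟩
  | mul a b ha hb =>
    obtain ⟨F, hF, a, rfl⟩ := ha
    obtain ⟨G, hG, b, rfl⟩ := hb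
    refine ⟨F ⊔ G, inferInstance, symMap (Submodule.inclusion le_sup_left) a *
      symMap (Submodule.inclusion le_sup_right) b, ?_⟩
    rw [map_mul, mono, mono]
  | add a b ha hb =>
    obtain ⟨F, hF, a, rfl⟩ := ha
    obtain ⟨G, hG, b, rfl⟩ := hb
    refine ⟨F ⊔ G, inferInstance, symMap (Submodule.inclusion le_sup_left) a +
      symMap (Submodule.inclusion le_sup_right) b, ?_⟩
    rw [map_add, mono, mono]

/-! ### The product of the antidual -/

theorem tensorAnti_tmul (Φ Ψ : Antidual V) (φ ψ : Sym V) :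
    tensorAnti Φ Ψ (φ ⊗ₜ ψ) = Φ φ * Ψ ψ := by
  simp [tensorAnti]

theorem annih'_apply (v : V) (Φ : Antidual V) (ψ : Sym V) : annih' v Φ ψ = Φ (inc V v * ψ) := rfl

theorem oneAnti_apply (ψ : Sym V) :
    (oneAnti : Antidual V) ψ = conj (Coalgebra.counit (R := ℂ) ψ) := rfl

theorem counit_inc_mul (v : V) (ψ : Sym V) : Coalgebra.counit (R := ℂ) (inc V v * ψ) = 0 := by
  rw [Bialgebra.counit_mul, SymmetricAlgebra.counit_ι, zero_mul]

theorem counit_homog_succ {n : ℕ} {ψ : Sym V} (h : ψ ∈ homog V (n + 1)) :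
    Coalgebra.counit (R := ℂ) ψ = 0 :=
  homog_succ_induction (P := fun ψ => Coalgebra.counit (R := ℂ) ψ = 0)
    (fun θ η h k => by rw [map_add, h, k, add_zero]) (fun v θ _ => counit_inc_mul v θ) h

theorem annih'_oneAnti (v : V) : annih' v (oneAnti : Antidual V) = 0 := by
  ext ψ
  change (oneAnti : Antidual V) (inc V v * ψ) = 0
  rw [oneAnti_apply, counit_inc_mul, map_zero]

/-- The annihilators are derivations of the antidual. -/
theorem annih'_mulAnti (v : V) (Φ Ψ : Antidual V) :
    annih' v (mulAnti Φ Ψ) = mulAnti (annih' v Φ) Ψ + mulAnti Φ (annih' v Ψ) := by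
  -- The two terms of Δv = v ⊗ 1 + 1 ⊗ v produce the two terms of the Leibniz rule.
  have h₁ : ∀ x, tensorAnti Φ Ψ ((inc V v ⊗ₜ 1) * x) = tensorAnti (annih' v Φ) Ψ x := by
    intro x
    induction x using TensorProduct.induction_on with
    | zero => simp
    | tmul a b => simp [tensorAnti_tmul, annih'_apply]
    | add a b ha hb => rw [mul_add, map_add, ha, hb, map_add]
  have h₂ : ∀ x, tensorAnti Φ Ψ ((1 ⊗ₜ inc V v) * x) = tensorAnti Φ (annih' v Ψ) x := by
    intro x
    induction x using TensorProduct.induction_on with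
    | zero => simp
    | tmul a b => simp [tensorAnti_tmul, annih'_apply]
    | add a b ha hb => rw [mul_add, map_add, ha, hb, map_add]
  ext θ
  change tensorAnti Φ Ψ (Coalgebra.comul (R := ℂ) (inc V v * θ)) =
    tensorAnti (annih' v Φ) Ψ (Coalgebra.comul (R := ℂ) θ) +
      tensorAnti Φ (annih' v Ψ) (Coalgebra.comul (R := ℂ) θ)
  rw [Bialgebra.comul_mul, SymmetricAlgebra.comul_ι, add_mul, map_add, h₁, h₂]

/-- Dual to the fact that a creator of the antidual is a multiplication operator and so can be
pulled out of a factor. Both sides have the same commutator with multiplication by v, since a(w) ⊗ 1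
sees only the summand v ⊗ 1 of Δv. -/
theorem comul_annih_left (w : V) (θ : Sym V) :
    Coalgebra.comul (R := ℂ) (annih w θ) =
      TensorProduct.map (annih w).toLinearMap LinearMap.id (Coalgebra.comul (R := ℂ) θ) := by
  induction θ using sym_induction with
  | one =>
    simp [Algebra.TensorProduct.one_def]
  | smul c θ h => rw [Derivation.map_smul, map_smul, map_smul, map_smul, h]
  | add θ η h k => simp only [map_add, h, k]
  | cons v θ ih =>
    have key : ∀ x : Sym V ⊗[ℂ] Sym V,
        TensorProduct.map (annih w).toLinearMap LinearMap.id
          ((inc V v ⊗ₜ 1 + 1 ⊗ₜ inc V v) * x) = inner ℂ w v • x +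
          (inc V v ⊗ₜ 1 + 1 ⊗ₜ inc V v) *
            TensorProduct.map (annih w).toLinearMap LinearMap.id x := by
      intro x
      induction x using TensorProduct.induction_on with
      | zero => simp
      | tmul a b =>
        simp only [add_mul, Algebra.TensorProduct.tmul_mul_tmul, one_mul, map_add,
          TensorProduct.map_tmul, Derivation.coeFn_coe, annih_inc_mul, LinearMap.id_apply,
          TensorProduct.add_tmul, TensorProduct.smul_tmul']
        abel
      | add a b ha hb => simp only [mul_add, map_add, ha, hb, smul_add]; abel
    rw [annih_inc_mul, map_add, map_smul, Bialgebra.comul_mul, Bialgebra.comul_mul,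
      SymmetricAlgebra.comul_ι, key, ih]

theorem comul_annih_right (w : V) (θ : Sym V) :
    Coalgebra.comul (R := ℂ) (annih w θ) =
      TensorProduct.map LinearMap.id (annih w).toLinearMap (Coalgebra.comul (R := ℂ) θ) := by
  have h := comul_annih_left w θ
  -- Cocommutativity carries the left version to the right one.
  have hc := fun θ : Sym V => Coalgebra.comm_comul (R := ℂ) θ
  rw [← hc, h]
  conv_rhs => rw [← hc θ]
  generalize Coalgebra.comul (R := ℂ) θ = x
  induction x using TensorProduct.induction_on with
  | zero => simp
  | tmul a b => simp
  | add a b ha hb => simp only [map_add, ha, hb]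

theorem mulAnti_creat'_left (w : V) (Φ Ψ : Antidual V) :
    mulAnti (creat' w Φ) Ψ = creat' w (mulAnti Φ Ψ) := by
  have h : ∀ x, tensorAnti (creat' w Φ) Ψ x =
      tensorAnti Φ Ψ (TensorProduct.map (annih w).toLinearMap LinearMap.id x) := by
    intro x
    induction x using TensorProduct.induction_on with
    | zero => simp
    | tmul a b => simp [tensorAnti_tmul]
    | add a b ha hb => simp only [map_add, ha, hb]
  ext θ
  change tensorAnti _ _ _ = tensorAnti _ _ _
  rw [h, ← comul_annih_left]
  rfl

theorem mulAnti_creat'_right (w : V) (Φ Ψ : Antidual V) :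
    mulAnti Φ (creat' w Ψ) = creat' w (mulAnti Φ Ψ) := by
  have h : ∀ x, tensorAnti Φ (creat' w Ψ) x =
      tensorAnti Φ Ψ (TensorProduct.map LinearMap.id (annih w).toLinearMap x) := by
    intro x
    induction x using TensorProduct.induction_on with
    | zero => simp
    | tmul a b => simp [tensorAnti_tmul]
    | add a b ha hb => simp only [map_add, ha, hb]
  ext θ
  change tensorAnti _ _ _ = tensorAnti _ _ _
  rw [h, ← comul_annih_right]
  rfl

theorem oneAnti_mulAnti (Φ : Antidual V) : mulAnti oneAnti Φ = Φ := by
  have h : ∀ x, tensorAnti oneAnti Φ x =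
      Φ (TensorProduct.lid ℂ (Sym V) ((Coalgebra.counit (R := ℂ)).rTensor (Sym V) x)) := by
    intro x
    induction x using TensorProduct.induction_on with
    | zero => simp
    | tmul a b => simp [tensorAnti_tmul, oneAnti_apply]
    | add a b ha hb => simp only [map_add, ha, hb]
  ext θ
  change tensorAnti _ _ _ = _
  rw [h, Coalgebra.rTensor_counit_comul, TensorProduct.lid_tmul, one_smul]

theorem mulAnti_smul_right (c : ℂ) (Φ Ψ : Antidual V) : mulAnti Φ (c • Ψ) = c • mulAnti Φ Ψ := by
  have h : ∀ x, tensorAnti Φ (c • Ψ) x = c * tensorAnti Φ Ψ x := by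
    intro x
    induction x using TensorProduct.induction_on with
    | zero => simp
    | tmul a b => simp [tensorAnti_tmul, mul_left_comm]
    | add a b ha hb => simp only [map_add, ha, hb, mul_add]
  ext θ
  exact h _

/-! ### Gaussians -/

/-- `u` satisfies `a(v) u = c(Zv) u` for all `v`, as the Gaussian `e^Z` does. -/
def IsGaussianLike (Z : V →ₗ⋆[ℂ] V) (u : Antidual V) : Prop :=
  ∀ v ψ, u (inc V v * ψ) = u (annih (Z v) ψ)

/-- The power rule for the derivation a(v): the hypothesis says that a(v)ζ is the vector Zv. -/
theorem annih'_powAnti {Z : V →ₗ⋆[ℂ] V} {ζ : Antidual V}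
    (hζ : ∀ v, annih' v ζ = creat' (Z v) oneAnti) (n : ℕ) (v : V) :
    annih' v (powAnti ζ (n + 1)) = ((n : ℂ) + 1) • creat' (Z v) (powAnti ζ n) := by
  induction n with
  | zero =>
    rw [show powAnti ζ (0 + 1) = mulAnti ζ oneAnti from rfl, annih'_mulAnti, hζ,
      mulAnti_creat'_left, oneAnti_mulAnti, powAnti, annih'_oneAnti]
    have : mulAnti ζ (0 : Antidual V) = 0 := by
      simpa using mulAnti_smul_right 0 ζ 0
    simp [this]
  | succ n ih =>
    rw [powAnti, annih'_mulAnti, hζ, mulAnti_creat'_left, oneAnti_mulAnti, ih, mulAnti_smul_right,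
      mulAnti_creat'_right, show mulAnti ζ (powAnti ζ n) = powAnti ζ (n + 1) from rfl]
    push_cast
    module

/-- The quadratic is recovered as the degree-two part of u. By the power rule the exponential series
satisfies the recursion of u, so convergence to u passes up the degrees. -/
theorem IsGaussianLike.isGaussian {Z : V →ₗ⋆[ℂ] V} {u : Antidual V} (h1 : u 1 = 1)
    (hu : IsGaussianLike Z u) : IsGaussian Z u := by
  have hinc : ∀ v w, u (inc V v * inc V w) = inner ℂ w (Z v) := fun v w => by
    rw [hu, annih_inc, Algebra.algebraMap_eq_smul_one, map_smulₛₗ, h1, inner_conj_symm, smul_eq_mul,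
      mul_one]
  have hinc_mem : ∀ v : V, inc V v ∈ homog V 1 := fun v => by
    simpa using inc_mul_mem_homog v one_mem_homog
  set ζ : Antidual V := u.comp (homProj 2) with hζdef
  have hζ : ∀ v, annih' v ζ = creat' (Z v) oneAnti := by
    intro v
    ext ψ
    change u (homProj 2 (inc V v * ψ)) = conj (Coalgebra.counit (R := ℂ) (annih (Z v) ψ))
    refine of_homog (P := fun ψ => u (homProj 2 (inc V v * ψ)) =
      conj (Coalgebra.counit (R := ℂ) (annih (Z v) ψ))) (by simp) (fun θ η h k => ?_)
      (fun n θ hθ => ?_) ψ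
    · simp only [mul_add, map_add, h, k]
    · match n with
      | 0 =>
        rw [homProj_of_mem_ne (inc_mul_mem_homog v hθ) (by norm_num), annih_homog_zero _ hθ]
        simp
      | 1 =>
        rw [homProj_of_mem (inc_mul_mem_homog v hθ)]
        refine homog_succ_induction (P := fun θ => u (inc V v * θ) =
          conj (Coalgebra.counit (R := ℂ) (annih (Z v) θ))) (fun θ η h k => ?_)
          (fun w θ hθ => ?_) hθ
        · simp only [mul_add, map_add, h, k]
        · refine homog_zero_induction (P := fun θ => u (inc V v * (inc V w * θ)) =
            conj (Coalgebra.counit (R := ℂ) (annih (Z v) (inc V w * θ)))) ?_ (fun c θ h => ?_) hθ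
          · rw [mul_one, hinc, annih_inc]
            simp
          · simp only [mul_smul_comm, map_smulₛₗ, h, Derivation.map_smul]
            simp
      | n + 2 =>
        rw [homProj_of_mem_ne (inc_mul_mem_homog v hθ) (by omega),
          counit_homog_succ (annih_mem_homog _ hθ)]
        simp
  refine ⟨ζ, fun n hn θ hθ => ?_, fun x y => ?_, fun θ => ?_⟩
  · rw [hζdef, LinearMap.comp_apply, homProj_of_mem_ne hθ (Ne.symm hn), map_zero]
  · rw [hζdef, LinearMap.comp_apply, homProj_of_mem (inc_mul_mem_homog x (hinc_mem y)), hinc]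
  · induction θ using degree_induction with
    | one =>
      have h0 : ζ 1 = 0 := by
        rw [hζdef, LinearMap.comp_apply, homProj_of_mem_ne one_mem_homog (by norm_num), map_zero]
      have hz : ∀ n : ℕ, n ≠ 0 → ((n.factorial : ℂ))⁻¹ * powAnti ζ n 1 = 0 := by
        intro n hn
        obtain ⟨n, rfl⟩ := Nat.exists_eq_succ_of_ne_zero hn
        have : powAnti ζ (n + 1) 1 = ζ 1 * powAnti ζ n 1 := by
          change tensorAnti ζ (powAnti ζ n) (Coalgebra.comul (R := ℂ) 1) = _
          rw [Bialgebra.comul_one, Algebra.TensorProduct.one_def, tensorAnti_tmul]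
        rw [Nat.succ_eq_add_one, this, h0, zero_mul, mul_zero]
      have := hasSum_single (f := fun n : ℕ => ((n.factorial : ℂ))⁻¹ * powAnti ζ n 1) 0 hz
      simpa [powAnti, oneAnti_apply, h1] using this
    | smul c θ h =>
      have := h.mul_left (conj c)
      simpa [mul_left_comm] using this
    | add θ η h k =>
      have := h.add k
      simpa [mul_add] using this
    | cons n v ψ hψ ih =>
      have key := annih_of_le (P := fun θ => HasSum
        (fun n : ℕ => ((n.factorial : ℂ))⁻¹ * powAnti ζ n θ) (u θ)) (by simp) ih (Z v) hψ
      -- The zeroth term vanishes on multiples of a vector; after the shift, the factor m + 1 of the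
      -- power rule cancels against (m + 1)!.
      rw [hu, ← hasSum_nat_add_iff' 1]
      have hzero : powAnti ζ 0 (inc V v * ψ) = 0 := by
        change conj (Coalgebra.counit (R := ℂ) (inc V v * ψ)) = 0
        rw [counit_inc_mul, map_zero]
      simp only [Finset.sum_range_one, hzero, mul_zero, sub_zero]
      refine key.congr_fun ?_
      intro m
      have hm : powAnti ζ (m + 1) (inc V v * ψ) =
          ((m : ℂ) + 1) * powAnti ζ m (annih (Z v) ψ) := congr($(annih'_powAnti hζ m v) ψ)
      have : (m : ℂ) + 1 ≠ 0 := by exact_mod_cast m.succ_ne_zero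
      rw [hm, Nat.factorial_succ]
      push_cast
      field_simp

/-- A linear map to an algebra with commuting values extends to the symmetric algebra. -/
theorem exists_algHom_of_commute {A : Type*} [Ring A] [Algebra ℂ A] (P : V →ₗ[ℂ] A)
    (h : ∀ v w, P v * P w = P w * P v) : ∃ Q : Sym V →ₐ[ℂ] A, ∀ v, Q (inc V v) = P v := by
  let S : Subalgebra ℂ A := Algebra.adjoin ℂ (Set.range P)
  let : CommRing S :=
    { S.toRing with
      mul_comm := (Algebra.isMulCommutative_adjoin ℂ (by
        rintro _ ⟨v, rfl⟩ _ ⟨w, rfl⟩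
        exact h v w)).is_comm.comm }
  let P' : V →ₗ[ℂ] S :=
    { toFun := fun v => ⟨P v, Algebra.subset_adjoin ⟨v, rfl⟩⟩
      map_add' := fun v w => by ext; simp
      map_smul' := fun c v => by ext; simp }
  refine ⟨S.val.comp (SymmetricAlgebra.lift P'), fun v => ?_⟩
  simp [P']

/-- Symmetry of Z makes the operators c(v) + a(Zv) commute, so they extend to an algebra
homomorphism Q on SV. The vacuum component of Q(θ)1, conjugated, is the desired functional: c(v)
contributes nothing to it. -/
theorem exists_isGaussianLike {Z : V →ₗ⋆[ℂ] V} (hZ : IsSymmetricAnti Z) :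
    ∃ u : Antidual V, u 1 = 1 ∧ IsGaussianLike Z u := by
  let P : V →ₗ[ℂ] Module.End ℂ (Sym V) :=
    { toFun := fun v => creat v + (annih (Z v)).toLinearMap
      map_add' := fun v w => by
        ext ψ; simp [creat, annih_add, add_mul]; abel
      map_smul' := fun c v => by
        ext ψ; simp [creat, annih_smul] }
  have hP : ∀ v ψ, P v ψ = inc V v * ψ + annih (Z v) ψ := fun v ψ => rfl
  obtain ⟨Q, hQ⟩ := exists_algHom_of_commute P (fun v w => by
    ext ψ
    simp only [Module.End.mul_apply, hP, map_add, mul_add, annih_inc_mul]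
    rw [annih_comm, mul_left_comm, ← inner_conj_symm, hZ v w, inner_conj_symm]
    abel)
  have hQ1 : ∀ v ψ, Q (inc V v * ψ) 1 = inc V v * Q ψ 1 + annih (Z v) (Q ψ 1) := fun v ψ => by
    rw [map_mul, hQ, Module.End.mul_apply, hP]
  -- a(x) has the same commutator ⟨x|v⟩ with c(v) + a(Zv) as with c(v).
  have comm : ∀ x ψ, annih x (Q ψ 1) = Q (annih x ψ) 1 := by
    intro x ψ
    induction ψ using sym_induction with
    | one => simp
    | smul c θ h => rw [map_smul, LinearMap.smul_apply, Derivation.map_smul, h,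
        Derivation.map_smul, map_smul, LinearMap.smul_apply]
    | add θ η h k => simp only [map_add, LinearMap.add_apply, h, k]
    | cons v θ ih =>
      rw [hQ1, map_add, annih_inc_mul, annih_comm, ih, annih_inc_mul, map_add, map_smul,
        LinearMap.add_apply, hQ1, LinearMap.smul_apply, add_assoc]
  let u : Antidual V :=
    { toFun := fun θ => conj (Coalgebra.counit (R := ℂ) (Q θ 1))
      map_add' := fun _ _ => by simp
      map_smul' := fun _ _ => by simp }
  have hu : ∀ θ, u θ = conj (Coalgebra.counit (R := ℂ) (Q θ 1)) := fun _ => rfl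
  refine ⟨u, by simp [hu], fun v ψ => ?_⟩
  rw [hu, hQ1, map_add, counit_inc_mul, zero_add, comm, hu]

/-! ### Antisymplectic automorphisms -/

section antisymplectic

variable {g : V ≃ₗ[ℝ] V}

theorem IsAntisymplectic.symm (hg : IsAntisymplectic g) : IsAntisymplectic g.symm := fun x y => by
  have := hg (g.symm x) (g.symm y)
  simp only [LinearEquiv.apply_symm_apply] at this
  linarith

theorem IsAntisymplectic.im_inner (hg : IsAntisymplectic g) (x y : V) :
    (inner ℂ (g x) y).im = -(inner ℂ x (g.symm y)).im := by
  have := hg x (g.symm y)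
  rwa [LinearEquiv.apply_symm_apply] at this

theorem linPart_apply (g : V ≃ₗ[ℝ] V) (v : V) :
    linPart g v = (2⁻¹ : ℂ) • (g v - Complex.I • g (Complex.I • v)) := rfl

theorem antiPart_apply (g : V ≃ₗ[ℝ] V) (v : V) :
    antiPart g v = (2⁻¹ : ℂ) • (g v + Complex.I • g (Complex.I • v)) := rfl

theorem linPart_add_antiPart (g : V ≃ₗ[ℝ] V) (v : V) : linPart g v + antiPart g v = g v := by
  rw [linPart_apply, antiPart_apply]
  module

theorem re_inner_eq_im (x y : V) : (inner ℂ x y).re = (inner ℂ x (Complex.I • y)).im := by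
  rw [inner_smul_right]; simp

/-- The Ω-adjoint of g is -g⁻¹. Averaging this relation over (x, y) and (ix, iy) isolates the
complex-linear parts, and Ω determines the inner product between complex-linear expressions. -/
theorem IsAntisymplectic.inner_linPart (hg : IsAntisymplectic g) (x y : V) :
    inner ℂ (linPart g x) y = -inner ℂ x (linPart g.symm y) := by
  have him : ∀ x y, (inner ℂ (linPart g x) y).im = -(inner ℂ x (linPart g.symm y)).im := by
    intro x y
    have h₁ := hg.im_inner x y
    have h₂ := hg.im_inner (Complex.I • x) (Complex.I • y)
    rw [inner_smul_right, inner_smul_left] at h₂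
    simp only [linPart_apply, inner_smul_left, inner_smul_right, inner_sub_left, inner_sub_right]
    simp [Complex.mul_im] at h₁ h₂ ⊢
    linarith
  apply Complex.ext
  · rw [re_inner_eq_im, him, Complex.neg_re, re_inner_eq_im, map_smul]
  · rw [him, Complex.neg_im]

theorem IsAntisymplectic.inner_antiPart (hg : IsAntisymplectic g) (x y : V) :
    inner ℂ (antiPart g x) y = inner ℂ (antiPart g.symm y) x := by
  have him : ∀ x y, (inner ℂ (antiPart g x) y).im = (inner ℂ (antiPart g.symm y) x).im := by
    intro x y
    have h₁ := hg.im_inner x y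
    have h₂ := congrArg Complex.im (hg.inner_linPart x y)
    rw [← linPart_add_antiPart, ← linPart_add_antiPart g.symm, inner_add_left,
      inner_add_right] at h₁
    have h₃ : (inner ℂ (antiPart g.symm y) x).im = -(inner ℂ x (antiPart g.symm y)).im := by
      rw [← inner_conj_symm, Complex.conj_im]
    simp only [Complex.add_im, Complex.neg_im] at h₁ h₂
    linarith
  apply Complex.ext
  · rw [re_inner_eq_im, him, map_smulₛₗ, inner_smul_left]; simp
  · exact him x y

theorem linPart_antiPart_comp (g : V ≃ₗ[ℝ] V) (v : V) :
    linPart g (linPart g.symm v) + antiPart g (antiPart g.symm v) = v ∧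
      linPart g (antiPart g.symm v) + antiPart g (linPart g.symm v) = 0 := by
  have h : ∀ v, linPart g (linPart g.symm v) + linPart g (antiPart g.symm v) +
      (antiPart g (linPart g.symm v) + antiPart g (antiPart g.symm v)) = v := by
    intro v
    rw [← map_add, ← map_add, linPart_add_antiPart, linPart_add_antiPart,
      LinearEquiv.apply_symm_apply]
  have h₁ := h v
  -- The identity at iv, divided by i: the mixed products are antilinear and change sign.
  have h₂ : linPart g (linPart g.symm v) - linPart g (antiPart g.symm v) +
      (-antiPart g (linPart g.symm v) + antiPart g (antiPart g.symm v)) = v := by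
    have hI := h (Complex.I • v)
    simp only [map_smulₛₗ, RingHom.id_apply, Complex.conj_I, map_neg, neg_neg] at hI
    apply smul_right_injective V Complex.I_ne_zero
    simp only
    rw [← hI]
    module
  constructor
  · linear_combination (norm := module) (2⁻¹ : ℂ) • h₁ + (2⁻¹ : ℂ) • h₂
  · linear_combination (norm := module) (2⁻¹ : ℂ) • h₁ - (2⁻¹ : ℂ) • h₂

theorem linPart_antiPart_comp' (g : V ≃ₗ[ℝ] V) (v : V) :
    linPart g.symm (linPart g v) + antiPart g.symm (antiPart g v) = v ∧
      linPart g.symm (antiPart g v) + antiPart g.symm (linPart g v) = 0 := by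
  simpa using linPart_antiPart_comp g.symm v

/-- A_{g⁻¹}A_g = 1 - C_{g⁻¹}C_g, where A_{g⁻¹} and -C_{g⁻¹} are the adjoints of A_g and C_g. -/
theorem IsAntisymplectic.norm_antiPart_sq (hg : IsAntisymplectic g) (v : V) :
    ‖antiPart g v‖ ^ 2 = ‖v‖ ^ 2 + ‖linPart g v‖ ^ 2 := by
  have h : inner ℂ (antiPart g v) (antiPart g v) = inner ℂ v v +
      inner ℂ (linPart g v) (linPart g v) := by
    have hc := eq_sub_of_add_eq' (linPart_antiPart_comp' g v).1
    have hl := hg.symm.inner_linPart (linPart g v) v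
    rw [LinearEquiv.symm_symm] at hl
    rw [hg.inner_antiPart, hc, inner_sub_left, hl, sub_neg_eq_add]
  simp only [inner_self_eq_norm_sq_to_K] at h
  exact_mod_cast h

theorem IsAntisymplectic.norm_le_norm_antiPart (hg : IsAntisymplectic g) (v : V) :
    ‖v‖ ≤ ‖antiPart g v‖ := by
  have := hg.norm_antiPart_sq v
  exact le_of_sq_le_sq (by nlinarith [sq_nonneg ‖linPart g v‖]) (norm_nonneg _)

theorem IsAntisymplectic.norm_linPart_le (hg : IsAntisymplectic g) (v : V) :
    ‖linPart g v‖ ≤ ‖antiPart g v‖ := by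
  have := hg.norm_antiPart_sq v
  exact le_of_sq_le_sq (by nlinarith [sq_nonneg ‖v‖]) (norm_nonneg _)

theorem antiInv_apply_apply {A : V →ₗ⋆[ℂ] V} (h : Function.Bijective A) (v : V) :
    antiInv A (A v) = v := by
  rw [antiInv, dif_pos h]
  exact (LinearEquiv.ofBijective A h).symm_apply_apply v

theorem apply_antiInv_apply {A : V →ₗ⋆[ℂ] V} (h : Function.Bijective A) (v : V) :
    A (antiInv A v) = v := by
  rw [antiInv, dif_pos h]
  exact (LinearEquiv.ofBijective A h).apply_symm_apply v

theorem anticomm_eq (g : V ≃ₗ[ℝ] V) : anticomm g = (2 * Complex.I) • linPart g := by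
  ext v
  rw [LinearMap.smul_apply, linPart_apply]
  change g (Complex.I • v) + Complex.I • g v = _
  match_scalars
  · linear_combination Complex.I_sq
  · ring

/-! ### The kernel of a metaplectic operator -/

theorem kernelZ_apply (g : V ≃ₗ[ℝ] V) (w : Double V) : kernelZ g w =
    (inc₁ (zPart g w.fst) + inc₂ (antiInv (antiPart g.symm) w.fst)) +
      (inc₁ (antiInv (antiPart g) w.snd) + inc₂ (zPart g.symm w.snd)) := rfl

theorem inner_inc₁ (w : Double V) (v : V) : inner ℂ w (inc₁ v) = inner ℂ w.fst v := by
  rw [WithLp.prod_inner_apply]; simp [inc₁]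

theorem inner_inc₂ (w : Double V) (v : V) : inner ℂ w (inc₂ v) = inner ℂ w.snd v := by
  rw [WithLp.prod_inner_apply]; simp [inc₂]

theorem annih_sym₁_mul_sym₂ (w : Double V) (φ ψ : Sym V) :
    annih w (sym₁ φ * sym₂ ψ) = sym₁ (annih w.fst φ) * sym₂ ψ + sym₁ φ * sym₂ (annih w.snd ψ) := by
  rw [Derivation.leibniz, sym₁_eq, sym₂_eq,
    annih_symMap (inc₁ (V := V)) (p := fun w => w.fst) inner_inc₁,
    annih_symMap (inc₂ (V := V)) (p := fun w => w.snd) inner_inc₂, smul_eq_mul, smul_eq_mul,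
    add_comm, mul_comm (symMap inc₂ ψ)]

theorem kernelOp_apply (u : Antidual (Double V)) (φ ψ : Sym V) :
    kernelOp u φ ψ = u (sym₁ φ * sym₂ ψ) := rfl

/-- The recursions satisfied by the map `SV → SV'` whose kernel is the Gaussian of `kernelZ g`. -/
structure IsKernelLike (g : V ≃ₗ[ℝ] V) (U : Sym V →ₗ⋆[ℂ] Antidual V) : Prop where
  inc_mul : ∀ v φ ψ, U (inc V v * φ) ψ =
    U (annih (zPart g v) φ) ψ + U φ (annih (antiInv (antiPart g.symm) v) ψ)
  apply_inc_mul : ∀ v φ ψ, U φ (inc V v * ψ) =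
    U (annih (antiInv (antiPart g) v) φ) ψ + U φ (annih (zPart g.symm v) ψ)

/-- Exchanging the two copies of V exchanges g and g⁻¹, so every result about U has a counterpart
for its transpose. -/
theorem IsKernelLike.flip {U : Sym V →ₗ⋆[ℂ] Antidual V} (hU : IsKernelLike g U) :
    IsKernelLike g.symm U.flip where
  inc_mul v φ ψ := by
    simp only [LinearMap.flip_apply, LinearEquiv.symm_symm]
    rw [hU.apply_inc_mul, add_comm]
  apply_inc_mul v φ ψ := by
    simp only [LinearMap.flip_apply, LinearEquiv.symm_symm]
    rw [hU.inc_mul, add_comm]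

/-- A vector of either copy is moved by the Gaussian recursion, and the resulting annihilator acts
on φ₁ψ₂ by the Leibniz rule, each component on its own factor. -/
theorem IsGaussianLike.isKernelLike {u : Antidual (Double V)}
    (hu : IsGaussianLike (kernelZ g) u) : IsKernelLike g (kernelOp u) where
  inc_mul v φ ψ := by
    have h : kernelZ g (inc₁ v) = inc₁ (zPart g v) + inc₂ (antiInv (antiPart g.symm) v) := by
      simp [kernelZ_apply, inc₁]
    rw [kernelOp_apply, map_mul sym₁, sym₁_eq, symMap_inc, ← sym₁_eq, mul_assoc, hu,
      annih_sym₁_mul_sym₂, map_add, h]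
    simp [inc₁, inc₂, kernelOp_apply]
  apply_inc_mul v φ ψ := by
    have h : kernelZ g (inc₂ v) = inc₁ (antiInv (antiPart g) v) + inc₂ (zPart g.symm v) := by
      simp [kernelZ_apply, inc₂]
    rw [kernelOp_apply, map_mul sym₂, sym₂_eq, symMap_inc, ← sym₂_eq, mul_left_comm, hu,
      annih_sym₁_mul_sym₂, map_add, h]
    simp [inc₁, inc₂, kernelOp_apply]

theorem IsWeakMetaplectic.smul {U : Sym V →ₗ⋆[ℂ] Antidual V} (hU : IsWeakMetaplectic g U) {c : ℂ}
    (hc : c ≠ 0) : IsWeakMetaplectic g (c • U) := by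
  refine ⟨smul_ne_zero hc hU.1, fun v φ => ?_, fun v φ => ?_⟩
  · simp only [LinearMap.smul_apply, hU.2.1, map_smul, smul_add]
  · simp only [LinearMap.smul_apply, hU.2.2, map_smul, smul_add]

/-! ### Metaplectic operators on a Hilbert space -/

variable [CompleteSpace V]

/-- An antisymplectic automorphism is bounded, by the closed graph theorem. -/
theorem IsAntisymplectic.exists_bound (hg : IsAntisymplectic g) :
    ∃ K : ℝ, 0 ≤ K ∧ ∀ v, ‖g v‖ ≤ K * ‖v‖ := by
  have hc : Continuous g.toLinearMap := by
    refine g.toLinearMap.continuous_of_seq_closed_graph fun x a y hx hy => ?_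
    -- Having an Ω-adjoint, g is weakly continuous; nondegeneracy of Ω then identifies the limit.
    have h : ∀ z, (inner ℂ y z).im = (inner ℂ (g a) z).im := by
      intro z
      have h₁ : Filter.Tendsto (fun n => (inner ℂ (g (x n)) z).im) Filter.atTop
          (nhds (inner ℂ y z).im) :=
        (Complex.continuous_im.tendsto _).comp (hy.inner tendsto_const_nhds)
      have h₂ : Filter.Tendsto (fun n => -(inner ℂ (x n) (g.symm z)).im) Filter.atTop
          (nhds (-(inner ℂ a (g.symm z)).im)) :=
        ((Complex.continuous_im.tendsto _).comp (hx.inner tendsto_const_nhds)).neg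
      simp only [← hg.im_inner] at h₂
      exact tendsto_nhds_unique h₁ h₂
    have h0 : (inner ℂ (y - g a) (y - g a)).re = 0 := by
      rw [re_inner_eq_im, inner_sub_left, Complex.sub_im, h, sub_self]
    exact sub_eq_zero.1 (inner_self_eq_zero.1 (Complex.ext h0 (inner_self_im (𝕜 := ℂ) _)))
  let G : V →L[ℝ] V := ⟨g.toLinearMap, hc⟩
  exact ⟨‖G‖, norm_nonneg _, fun v => G.le_opNorm v⟩

theorem IsAntisymplectic.exists_antiPart_bound (hg : IsAntisymplectic g) :
    ∃ K : ℝ, 1 ≤ K ∧ ∀ v, ‖antiPart g v‖ ≤ K * ‖v‖ := by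
  obtain ⟨K, hK, h⟩ := hg.exists_bound
  -- K already bounds A_g; the added 1 makes the constant at least 1, so that 1 - 1/K² is
  -- nonnegative in the contraction estimate.
  refine ⟨K + 1, by linarith, fun v => ?_⟩
  have h₁ := h v
  have h₂ := h (Complex.I • v)
  rw [norm_smul, Complex.norm_I, one_mul] at h₂
  rw [antiPart_apply, norm_smul]
  have h₃ := norm_add_le (g v) (Complex.I • g (Complex.I • v))
  rw [norm_smul, Complex.norm_I, one_mul] at h₃
  have : ‖(2⁻¹ : ℂ)‖ = 2⁻¹ := by simp
  rw [this]
  linarith [norm_nonneg v]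

/-- A_g is bounded and bounded below, hence injective with closed range. The orthogonal complement
of the range is the kernel of the adjoint A_{g⁻¹}, which is bounded below too. -/
theorem IsAntisymplectic.bijective_antiPart (hg : IsAntisymplectic g) :
    Function.Bijective (antiPart g) := by
  have hinj : Function.Injective (antiPart g) := by
    rw [injective_iff_map_eq_zero]
    intro v hv
    have := hg.norm_le_norm_antiPart v
    rwa [hv, norm_zero, norm_le_zero_iff] at this
  refine ⟨hinj, LinearMap.range_eq_top.1 ?_⟩
  obtain ⟨K, hK, hb⟩ := hg.exists_antiPart_bound
  have hanti : AntilipschitzWith 1 (antiPart g) :=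
    AddMonoidHomClass.antilipschitz_of_bound (antiPart g) fun v => by
      simpa using hg.norm_le_norm_antiPart v
  have hlip : UniformContinuous (antiPart g) :=
    (AddMonoidHomClass.lipschitz_of_bound (antiPart g) K hb).uniformContinuous
  have hclosed : IsClosed (LinearMap.range (antiPart g) : Set V) := by
    rw [LinearMap.coe_range]
    exact hanti.isClosed_range hlip
  have := hclosed.completeSpace_coe
  rw [← Submodule.orthogonal_eq_bot_iff, Submodule.eq_bot_iff]
  intro y hy
  rw [Submodule.mem_orthogonal] at hy
  have h0 : antiPart g.symm y = 0 := by
    refine ext_inner_right ℂ fun x => ?_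
    rw [← hg.inner_antiPart, hy _ ⟨x, rfl⟩, inner_zero_left]
  have := hg.symm.norm_le_norm_antiPart y
  rwa [h0, norm_zero, norm_le_zero_iff] at this

theorem IsAntisymplectic.antiPart_zPart (hg : IsAntisymplectic g) (v : V) :
    antiPart g (zPart g v) = linPart g v :=
  apply_antiInv_apply hg.bijective_antiPart _

/-- The antilinear part of gg⁻¹ = 1. It gives the second expression Z_g = -C_{g⁻¹}A_{g⁻¹}⁻¹, used
below by writing vectors as A_{g⁻¹}b. -/
theorem IsAntisymplectic.zPart_antiPart (hg : IsAntisymplectic g) (v : V) :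
    zPart g (antiPart g.symm v) = -linPart g.symm v := by
  apply hg.bijective_antiPart.1
  rw [hg.antiPart_zPart, map_neg]
  exact eq_neg_of_add_eq_zero_left (linPart_antiPart_comp g v).2

theorem IsAntisymplectic.isSymmetricAnti_zPart (hg : IsAntisymplectic g) :
    IsSymmetricAnti (zPart g) := by
  intro x y
  obtain ⟨b, rfl⟩ := hg.symm.bijective_antiPart.2 y
  rw [hg.zPart_antiPart, ← hg.inner_antiPart, hg.antiPart_zPart, hg.inner_linPart, inner_neg_right]

theorem IsAntisymplectic.exists_zPart_bound (hg : IsAntisymplectic g) :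
    ∃ k : ℝ, 0 ≤ k ∧ k < 1 ∧ ∀ v, ‖zPart g v‖ ≤ k * ‖v‖ := by
  obtain ⟨K, hK, hb⟩ := hg.symm.exists_antiPart_bound
  have hK2 : 0 ≤ 1 - 1 / K ^ 2 := by
    rw [sub_nonneg, div_le_one (by positivity)]
    nlinarith
  -- For v = A_{g⁻¹}b the norm identity gives ‖Z_g v‖² = ‖v‖² - ‖b‖², and ‖b‖ ≥ ‖v‖/K.
  refine ⟨√(1 - 1 / K ^ 2), Real.sqrt_nonneg _, ?_, fun v => ?_⟩
  · rw [Real.sqrt_lt' one_pos, one_pow]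
    have : 0 < 1 / K ^ 2 := by positivity
    linarith
  · obtain ⟨b, rfl⟩ := hg.symm.bijective_antiPart.2 v
    rw [hg.zPart_antiPart, norm_neg]
    refine le_of_sq_le_sq ?_ (by positivity)
    have h₁ := hg.symm.norm_antiPart_sq b
    rw [mul_pow, Real.sq_sqrt hK2, sub_mul, one_mul]
    have h₂ : 1 / K ^ 2 * ‖antiPart g.symm b‖ ^ 2 ≤ ‖b‖ ^ 2 := by
      rw [one_div, inv_mul_le_iff₀ (by positivity), ← mul_pow]
      exact pow_le_pow_left₀ (norm_nonneg _) (hb b) 2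
    linarith

/-- At v = A_{g⁻¹}b this is the linear part of gg⁻¹ = 1. It supplies the creator coefficient in the
first intertwining relation. -/
theorem IsAntisymplectic.linPart_zPart (hg : IsAntisymplectic g) (v : V) :
    linPart g (zPart g v) + antiInv (antiPart g.symm) v = antiPart g v := by
  obtain ⟨b, rfl⟩ := hg.symm.bijective_antiPart.2 v
  rw [hg.zPart_antiPart, antiInv_apply_apply hg.symm.bijective_antiPart, map_neg]
  have := (linPart_antiPart_comp g b).1
  rw [neg_add_eq_iff_eq_add, this]

theorem IsAntisymplectic.inner_antiInv (hg : IsAntisymplectic g) (x y : V) :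
    inner ℂ x (antiInv (antiPart g) y) = inner ℂ y (antiInv (antiPart g.symm) x) := by
  obtain ⟨a, rfl⟩ := hg.bijective_antiPart.2 y
  obtain ⟨b, rfl⟩ := hg.symm.bijective_antiPart.2 x
  rw [antiInv_apply_apply hg.bijective_antiPart, antiInv_apply_apply hg.symm.bijective_antiPart,
    hg.inner_antiPart]

theorem IsAntisymplectic.isSymmetricAnti_kernelZ (hg : IsAntisymplectic g) :
    IsSymmetricAnti (kernelZ g) := by
  intro x y
  simp only [kernelZ_apply, inner_add_right, inner_inc₁, inner_inc₂]
  rw [hg.isSymmetricAnti_zPart x.fst, hg.symm.isSymmetricAnti_zPart x.snd,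
    hg.inner_antiInv y.fst, ← hg.inner_antiInv x.fst]
  ring

/-- The second-argument recursion at A_g v, where A_g⁻¹ cancels and Z_{g⁻¹}A_g = -C_g. -/
theorem IsKernelLike.apply_annih (hg : IsAntisymplectic g) {U : Sym V →ₗ⋆[ℂ] Antidual V}
    (hU : IsKernelLike g U) (v : V) (φ : Sym V) :
    U (annih v φ) = annih' (antiPart g v) (U φ) + creat' (linPart g v) (U φ) := by
  ext ψ
  have h := hU.apply_inc_mul (antiPart g v) φ ψ
  have hz := hg.symm.zPart_antiPart v
  rw [LinearEquiv.symm_symm] at hz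
  rw [antiInv_apply_apply hg.bijective_antiPart, hz, ← neg_one_smul ℂ, annih_smul] at h
  change _ = U φ (inc V (antiPart g v) * ψ) + U φ (annih (linPart g v) ψ)
  rw [h]
  simp

theorem IsKernelLike.isWeakMetaplectic (hg : IsAntisymplectic g) {U : Sym V →ₗ⋆[ℂ] Antidual V}
    (hU : IsKernelLike g U) (h1 : U 1 1 = 1) : IsWeakMetaplectic g U := by
  refine ⟨fun h => ?_, fun v φ => ?_, fun v φ => hU.apply_annih hg v φ⟩
  · simp [h] at h1
  · ext ψ
    change U (inc V v * φ) ψ = _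
    -- The annihilator relation at Z_g v turns a(Z_g v) into a(C_g v) + c(C_g Z_g v); with the
    -- remaining c(A_{g⁻¹}⁻¹v) the creators add up to c(A_g v).
    rw [hU.inc_mul, hU.apply_annih hg, hg.antiPart_zPart, LinearMap.add_apply,
      LinearMap.add_apply, creat'_apply, creat'_apply, ← hg.linPart_zPart v, annih_add,
      Derivation.add_apply, map_add, add_assoc]

/-- A solution of the intertwining relations is determined by its vacuum expectation. -/
theorem IsAntisymplectic.eq_zero_of_intertwines (hg : IsAntisymplectic g)
    {U : Sym V →ₗ⋆[ℂ] Antidual V} (h0 : U 1 1 = 0)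
    (hc : ∀ v φ, U (creat v φ) = annih' (linPart g v) (U φ) + creat' (antiPart g v) (U φ))
    (ha : ∀ v φ, U (annih v φ) = annih' (antiPart g v) (U φ) + creat' (linPart g v) (U φ)) :
    U = 0 := by
  have h1 : U 1 = 0 := by
    -- Since the vacuum is annihilated by a(A_g⁻¹v), its image satisfies a Gaussian recursion and is
    -- determined by its value at 1.
    refine antidual_eq_zero (fun v => -linPart g (antiInv (antiPart g) v)) _ h0 fun v ψ => ?_
    have h := congr($(ha (antiInv (antiPart g) v) 1) ψ)
    rw [Derivation.map_one_eq_zero, map_zero, LinearMap.add_apply, creat'_apply, annih'_apply,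
      apply_antiInv_apply hg.bijective_antiPart, LinearMap.zero_apply] at h
    rw [← neg_one_smul ℂ (linPart g _), annih_smul]
    simpa using (eq_neg_of_add_eq_zero_left h.symm)
  ext φ : 1
  change U φ = 0
  induction φ using sym_induction with
  | one => exact h1
  | smul c θ h => rw [map_smulₛₗ, h, smul_zero]
  | add θ η h k => rw [map_add, h, k, add_zero]
  | cons v θ h =>
    have := hc v θ
    rw [h, map_zero, map_zero, add_zero] at this
    exact this

/-- The relations are linear in U, so subtracting the multiple of T with the same vacuum expectation
leaves a solution with vanishing expectation. -/
theorem IsAntisymplectic.exists_smul_eq (hg : IsAntisymplectic g) {U T : Sym V →ₗ⋆[ℂ] Antidual V}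
    (hU : IsWeakMetaplectic g U) (hT : IsWeakMetaplectic g T) (h1 : T 1 1 = 1) :
    ∃ c : ℂ, c ≠ 0 ∧ U = c • T := by
  have h : U - U 1 1 • T = 0 := by
    refine hg.eq_zero_of_intertwines ?_ (fun v φ => ?_) fun v φ => ?_
    · simp [h1]
    · simp only [LinearMap.sub_apply, LinearMap.smul_apply, hU.2.1, hT.2.1, map_sub, map_smul]
      module
    · simp only [LinearMap.sub_apply, LinearMap.smul_apply, hU.2.2, hT.2.2, map_sub, map_smul]
      module
  rw [sub_eq_zero] at h
  refine ⟨U 1 1, fun h0 => hU.1 ?_, h⟩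
  rw [h, h0, zero_smul]

end antisymplectic

/-! ### The symmetric algebra as an inner product space -/

theorem innerS_inc_mul_left (v : V) (ψ φ : Sym V) :
    innerS (inc V v * ψ) φ = innerS ψ (annih v φ) := by
  induction φ using sym_induction generalizing ψ with
  | one =>
    rw [innerS_one, counit_inc_mul, Derivation.map_one_eq_zero, map_zero]
    exact (map_zero (embed (V := V)) ▸ rfl : (0 : ℂ) = embed 0 ψ)
  | smul c θ h => rw [innerS_smul_right, h, Derivation.map_smul, innerS_smul_right]
  | add θ η h k => rw [innerS_add_right, h, k, map_add, innerS_add_right]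
  | cons w θ ih =>
    rw [innerS_inc_mul, annih_inc_mul, annih_inc_mul, innerS_add_left, innerS_smul_left, ih,
      inner_conj_symm, innerS_add_right, innerS_smul_right, innerS_inc_mul]

theorem innerS_one_left (φ : Sym V) : innerS 1 φ = Coalgebra.counit (R := ℂ) φ := by
  induction φ using sym_induction with
  | one => simp [innerS_one]
  | smul c θ h => rw [innerS_smul_right, h, map_smul, smul_eq_mul]
  | add θ η h k => rw [innerS_add_right, h, k, map_add]
  | cons w θ ih =>
    rw [innerS_inc_mul, counit_inc_mul, Derivation.map_one_eq_zero]
    exact map_zero (embed θ)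

theorem innerS_conj_symm (ψ φ : Sym V) : conj (innerS φ ψ) = innerS ψ φ := by
  induction φ using sym_induction generalizing ψ with
  | one => rw [innerS_one_left, innerS_one]
  | smul c θ h => rw [innerS_smul_left, map_mul, h, Complex.conj_conj, innerS_smul_right]
  | add θ η h k => rw [innerS_add_left, map_add, h, k, innerS_add_right]
  | cons w θ ih => rw [innerS_inc_mul_left, ih, innerS_inc_mul]

theorem innerS_sum_right {ι : Type*} (s : Finset ι) (f : ι → Sym V) (ψ : Sym V) :
    innerS ψ (∑ i ∈ s, f i) = ∑ i ∈ s, innerS ψ (f i) := by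
  simp [innerS]

theorem innerS_sum_left {ι : Type*} (s : Finset ι) (f : ι → Sym V) (φ : Sym V) :
    innerS (∑ i ∈ s, f i) φ = ∑ i ∈ s, innerS (f i) φ := by
  simp [innerS]

theorem innerS_zero_left (φ : Sym V) : innerS 0 φ = 0 := map_zero (embed φ)

theorem innerS_eq_zero_of_ne {m n : ℕ} (h : m ≠ n) {ψ φ : Sym V} (hψ : ψ ∈ homog V m)
    (hφ : φ ∈ homog V n) : innerS ψ φ = 0 := by
  induction n generalizing m ψ φ with
  | zero =>
    obtain ⟨m, rfl⟩ := Nat.exists_eq_succ_of_ne_zero h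
    refine homog_zero_induction (P := fun φ => innerS ψ φ = 0) ?_ (fun c θ h => ?_) hφ
    · rw [innerS_one, counit_homog_succ hψ, map_zero]
    · rw [innerS_smul_right, h, mul_zero]
  | succ n ih =>
    refine homog_succ_induction (P := fun φ => innerS ψ φ = 0) (fun θ η h k => ?_)
      (fun v θ hθ => ?_) hφ
    · rw [innerS_add_right, h, k, add_zero]
    · rw [innerS_inc_mul]
      cases m with
      | zero => rw [annih_homog_zero v hψ, innerS_zero_left]
      | succ m => exact ih (by omega) (annih_mem_homog v hψ) hθ

/-- The number operator of a finite-dimensional space is `∑ₖ c(eₖ) a(eₖ)`. -/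
theorem sum_inc_mul_annih {ι : Type*} [Fintype ι] (e : OrthonormalBasis ι ℂ V) {n : ℕ}
    {ψ : Sym V} (hψ : ψ ∈ homog V n) : ∑ k, inc V (e k) * annih (e k) ψ = (n : ℂ) • ψ := by
  induction n generalizing ψ with
  | zero => simp [annih_homog_zero _ hψ]
  | succ n ih =>
    refine homog_succ_induction
      (P := fun ψ => ∑ k, inc V (e k) * annih (e k) ψ = ((n + 1 : ℕ) : ℂ) • ψ)
      (fun θ η h k => ?_) (fun w θ hθ => ?_) hψ
    · simp only [map_add, mul_add, Finset.sum_add_distrib, h, k, smul_add]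
    · have h₁ : inc V w = ∑ k, inner ℂ (e k) w • inc V (e k) := by
        conv_lhs => rw [← e.sum_repr' w]
        simp
      have h₂ := ih hθ
      simp only [annih_inc_mul, mul_add, Finset.sum_add_distrib, mul_left_comm _ (inc V w)]
      rw [← Finset.mul_sum, h₂]
      have h₃ : ∑ k, inc V (e k) * inner ℂ (e k) w • θ = inc V w * θ := by
        conv_rhs => rw [h₁, Finset.sum_mul]
        simp
      rw [h₃]
      push_cast
      rw [add_smul, one_smul, mul_smul_comm, add_comm]

/-- The number operator is ∑ c(e_k)a(e_k) and has eigenvalue n. This expresses the form in degree n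
as a sum of squares one degree lower, which drives both positivity and the Gaussian estimates. -/
theorem innerS_self_homog {ι : Type*} [Fintype ι] (e : OrthonormalBasis ι ℂ V) {n : ℕ}
    {ψ : Sym V} (hψ : ψ ∈ homog V n) :
    (n : ℂ) * innerS ψ ψ = ∑ k, innerS (annih (e k) ψ) (annih (e k) ψ) := by
  rw [← innerS_smul_right, ← sum_inc_mul_annih e hψ, innerS_sum_right]
  simp only [innerS_inc_mul]

theorem innerS_self_eq_sum {ψ : Sym V} {N : ℕ} (hN : ∑ n ∈ Finset.range N, homProj n ψ = ψ) :
    innerS ψ ψ = ∑ n ∈ Finset.range N, innerS (homProj n ψ) (homProj n ψ) := by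
  conv_lhs => rw [← hN]
  rw [innerS_sum_left]
  refine Finset.sum_congr rfl fun n hn => ?_
  rw [innerS_sum_right]
  exact Finset.sum_eq_single_of_mem n hn fun m _ hm =>
    innerS_eq_zero_of_ne (Ne.symm hm) (homProj_mem _ _) (homProj_mem _ _)

theorem innerS_self_pos_of_finiteDimensional [FiniteDimensional ℂ V] (ψ : Sym V) :
    0 ≤ (innerS ψ ψ).re ∧ ((innerS ψ ψ).re = 0 → ψ = 0) := by
  have key : ∀ (n : ℕ), ∀ ψ ∈ homog V n, 0 ≤ (innerS ψ ψ).re ∧ ((innerS ψ ψ).re = 0 → ψ = 0) := by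
    let e := stdOrthonormalBasis ℂ V
    intro n
    induction n with
    | zero =>
      intro ψ hψ
      rw [homog, pow_zero] at hψ
      obtain ⟨c, rfl⟩ := Submodule.mem_one.1 hψ
      have h : (innerS (algebraMap ℂ (Sym V) c) (algebraMap ℂ (Sym V) c)).re = ‖c‖ ^ 2 := by
        rw [Algebra.algebraMap_eq_smul_one, innerS_smul_left, innerS_smul_right, innerS_one,
          Bialgebra.counit_one, map_one, mul_one, mul_comm, Complex.mul_conj,
          Complex.normSq_eq_norm_sq, Complex.ofReal_re]
      rw [h]
      refine ⟨by positivity, fun h => ?_⟩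
      rw [sq_eq_zero_iff, norm_eq_zero] at h
      rw [h, map_zero]
    | succ n ih =>
      intro ψ hψ
      have h := congrArg Complex.re (innerS_self_homog e hψ)
      rw [← Complex.ofReal_natCast, Complex.re_ofReal_mul, Complex.re_sum] at h
      have hpos : (0 : ℝ) < ((n + 1 : ℕ) : ℝ) := by positivity
      have hk := fun k => ih _ (annih_mem_homog (e k) hψ)
      refine ⟨?_, fun h0 => ?_⟩
      · have : 0 ≤ ∑ k, (innerS (annih (e k) ψ) (annih (e k) ψ)).re :=
          Finset.sum_nonneg fun k _ => (hk k).1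
        rw [← h] at this
        exact nonneg_of_mul_nonneg_right this hpos
      · rw [h0, mul_zero, eq_comm, Finset.sum_eq_zero_iff_of_nonneg fun k _ => (hk k).1] at h
        have h' := sum_inc_mul_annih e hψ
        rw [Finset.sum_eq_zero fun k hkm => by rw [(hk k).2 (h k hkm), mul_zero]] at h'
        exact (smul_eq_zero.1 h'.symm).resolve_left (by exact_mod_cast n.succ_ne_zero)
  obtain ⟨N, hN⟩ := sum_homProj ψ
  have hk := fun n => key n _ (homProj_mem n ψ)
  rw [innerS_self_eq_sum hN, Complex.re_sum]
  refine ⟨Finset.sum_nonneg fun n _ => (hk n).1, fun h => ?_⟩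
  rw [Finset.sum_eq_zero_iff_of_nonneg fun k _ => (hk k).1] at h
  rw [← hN]
  exact Finset.sum_eq_zero fun n hn => (hk n).2 (h n hn)

/-- The inclusion has the orthogonal projection as adjoint, and projecting after including is the
identity. Positivity thereby reduces to finite dimensions. -/
theorem innerS_symMap_subtype (F : Submodule ℂ V) [FiniteDimensional ℂ F] (ψ φ : Sym F) :
    innerS (symMap F.subtype ψ) (symMap F.subtype φ) = innerS ψ φ := by
  rw [innerS_symMap F.subtype (F.orthogonalProjectionOnto : V →ₗ[ℂ] F) (fun v w => by
    simp), symMap_comp_apply]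
  have : (F.orthogonalProjectionOnto : V →ₗ[ℂ] F) ∘ₗ F.subtype = LinearMap.id := by
    ext x; simp
  rw [this, symMap_id]

theorem innerS_self_pos (ψ : Sym V) :
    0 ≤ (innerS ψ ψ).re ∧ ((innerS ψ ψ).re = 0 → ψ = 0) := by
  obtain ⟨F, hF, η, rfl⟩ := exists_finiteDimensional ψ
  rw [innerS_symMap_subtype]
  have := innerS_self_pos_of_finiteDimensional η
  exact ⟨this.1, fun h => by rw [this.2 h, map_zero]⟩

/-- The canonical inner product of `SV`. -/
@[reducible]
def symCore (V : Type*) [NormedAddCommGroup V] [InnerProductSpace ℂ V] :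
    InnerProductSpace.Core ℂ (Sym V) where
  inner := innerS
  conj_inner_symm := innerS_conj_symm
  re_inner_nonneg ψ := (innerS_self_pos ψ).1
  add_left := innerS_add_left
  smul_left ψ φ c := innerS_smul_left c ψ φ
  definite ψ h := (innerS_self_pos ψ).2 (by rw [h, Complex.zero_re])

/-- The normed group structure of `SV`. -/
abbrev symNormedAddCommGroup : NormedAddCommGroup (Sym V) :=
  (symCore V).toNormedAddCommGroup

attribute [local instance] symNormedAddCommGroup

/-- The inner product space structure of `SV`. -/
abbrev symInnerProductSpace : InnerProductSpace ℂ (Sym V) :=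
  InnerProductSpace.ofCore (symCore V).toCore

attribute [local instance] symInnerProductSpace

theorem sqrt_innerS_self (ψ : Sym V) : √(innerS ψ ψ).re = ‖ψ‖ := rfl

theorem inner_inc_mul_right (v : V) (ψ φ : Sym V) :
    inner ℂ ψ (inc V v * φ) = inner ℂ (annih v ψ) φ := innerS_inc_mul v ψ φ

theorem inner_inc_mul_left (v : V) (ψ φ : Sym V) :
    inner ℂ (inc V v * ψ) φ = inner ℂ ψ (annih v φ) := innerS_inc_mul_left v ψ φ

theorem norm_one_sym : ‖(1 : Sym V)‖ = 1 := by
  rw [← sqrt_innerS_self, innerS_one]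
  simp

theorem norm_inc_mul_sq (v : V) (ψ : Sym V) :
    ‖inc V v * ψ‖ ^ 2 = ‖v‖ ^ 2 * ‖ψ‖ ^ 2 + ‖annih v ψ‖ ^ 2 := by
  have h : inner ℂ (inc V v * ψ) (inc V v * ψ) =
      inner ℂ v v * inner ℂ ψ ψ + inner ℂ (annih v ψ) (annih v ψ) := by
    rw [inner_inc_mul_left, annih_inc_mul, inner_add_right, inner_smul_right, inner_inc_mul_right]
  simp only [inner_self_eq_norm_sq_to_K] at h
  exact_mod_cast h

/-- Cauchy–Schwarz for ‖a(v)ψ‖² = ⟨ψ|c(v)a(v)ψ⟩, where the norm of c(v)a(v)ψ is controlled by the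
commutation relation and the bound one degree lower. -/
theorem norm_annih_sq_le (n : ℕ) (v : V) {ψ : Sym V} (hψ : ψ ∈ homog V n) :
    ‖annih v ψ‖ ^ 2 ≤ n * ‖v‖ ^ 2 * ‖ψ‖ ^ 2 := by
  induction n generalizing ψ with
  | zero => simp [annih_homog_zero v hψ]
  | succ n ih =>
    have h₁ := norm_inc_mul_sq v (annih v ψ)
    have h₂ := ih (annih_mem_homog v hψ)
    have h₃ : ‖annih v ψ‖ ^ 2 ≤ ‖ψ‖ * ‖inc V v * annih v ψ‖ := by
      have : (‖annih v ψ‖ ^ 2 : ℝ) = ‖inner ℂ ψ (inc V v * annih v ψ)‖ := by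
        rw [inner_inc_mul_right, inner_self_eq_norm_sq_to_K]
        simp
      rw [this]
      exact norm_inner_le_norm _ _
    push_cast
    have h₄ : (‖annih v ψ‖ ^ 2) ^ 2 ≤ ‖ψ‖ ^ 2 * ((n + 1) * ‖v‖ ^ 2 * ‖annih v ψ‖ ^ 2) := by
      calc (‖annih v ψ‖ ^ 2) ^ 2 ≤ (‖ψ‖ * ‖inc V v * annih v ψ‖) ^ 2 :=
            pow_le_pow_left₀ (by positivity) h₃ 2
        _ = ‖ψ‖ ^ 2 * ‖inc V v * annih v ψ‖ ^ 2 := mul_pow _ _ _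
        _ ≤ _ := by gcongr; linarith
    rcases eq_or_lt_of_le (sq_nonneg ‖annih v ψ‖) with h | h
    · rw [← h]; positivity
    · nlinarith

theorem norm_annih_le (n : ℕ) (v : V) {ψ : Sym V} (hψ : ψ ∈ homog V n) :
    ‖annih v ψ‖ ≤ (n + 1) * ‖v‖ * ‖ψ‖ := by
  refine le_of_sq_le_sq ((norm_annih_sq_le n v hψ).trans ?_) (by positivity)
  rw [mul_pow, mul_pow]
  gcongr
  nlinarith [(Nat.cast_nonneg n : (0 : ℝ) ≤ n)]

theorem norm_inc_mul_le (n : ℕ) (v : V) {ψ : Sym V} (hψ : ψ ∈ homog V n) :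
    ‖inc V v * ψ‖ ≤ (n + 1) * ‖v‖ * ‖ψ‖ := by
  refine le_of_sq_le_sq ?_ (by positivity)
  rw [norm_inc_mul_sq, mul_pow, mul_pow]
  have h := norm_annih_sq_le n v hψ
  have : ((n : ℝ) + 1) * (‖v‖ ^ 2 * ‖ψ‖ ^ 2) ≤ (n + 1) ^ 2 * (‖v‖ ^ 2 * ‖ψ‖ ^ 2) := by
    gcongr
    nlinarith [(Nat.cast_nonneg n : (0 : ℝ) ≤ n)]
  linarith

theorem norm_homProj_le (n : ℕ) (ψ : Sym V) : ‖homProj n ψ‖ ≤ ‖ψ‖ := by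
  obtain ⟨N, hN⟩ := sum_homProj ψ
  have h : inner ℂ (homProj n ψ) ψ = inner ℂ (homProj n ψ) (homProj n ψ) := by
    refine of_homog (P := fun φ => inner ℂ (homProj n ψ) φ = inner ℂ (homProj n ψ) (homProj n φ))
      (by simp) (fun θ η h k => ?_) (fun m θ hθ => ?_) ψ
    · rw [map_add, inner_add_right, h, k, inner_add_right]
    · by_cases hm : n = m
      · subst hm; rw [homProj_of_mem hθ]
      · rw [homProj_of_mem_ne hθ hm, inner_zero_right]
        exact innerS_eq_zero_of_ne hm (homProj_mem _ _) hθ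
  have h₂ : ‖homProj n ψ‖ ^ 2 ≤ ‖homProj n ψ‖ * ‖ψ‖ := by
    have h₃ := norm_inner_le_norm (𝕜 := ℂ) (homProj n ψ) ψ
    rw [h, inner_self_eq_norm_sq_to_K] at h₃
    simpa using h₃
  rcases eq_or_lt_of_le (norm_nonneg (homProj n ψ)) with h | h
  · rw [← h]; exact norm_nonneg _
  · nlinarith

/-! ### Dilations -/

/-- The dilation `r^N`, with `N` the number operator. -/
def dil (r : ℝ) : Sym V →ₐ[ℂ] Sym V := symMap ((r : ℂ) • LinearMap.id)

@[simp]
theorem dil_inc (r : ℝ) (v : V) : dil r (inc V v) = (r : ℂ) • inc V v := by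
  rw [dil, symMap_inc, LinearMap.smul_apply, map_smul, LinearMap.id_apply]

theorem annih_dil (r : ℝ) (v : V) (ψ : Sym V) :
    annih v (dil r ψ) = (r : ℂ) • dil r (annih v ψ) := by
  rw [dil, annih_symMap (p := fun v => (r : ℂ) • v) _ (fun v w => by
    simp), annih_smul, Complex.conj_ofReal, Derivation.smul_apply, map_smul]

theorem inner_dil (r : ℝ) (ψ φ : Sym V) : inner ℂ (dil r ψ) φ = inner ℂ ψ (dil r φ) :=
  innerS_symMap _ _ (fun v w => by simp) ψ φ

theorem dil_dil (r s : ℝ) (ψ : Sym V) : dil r (dil s ψ) = dil (r * s) ψ := by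
  rw [dil, dil, symMap_comp_apply, dil]
  congr 2
  ext v
  simp only [LinearMap.comp_apply, LinearMap.smul_apply, LinearMap.id_apply, smul_smul,
    Complex.ofReal_mul]

theorem dil_one (ψ : Sym V) : dil 1 ψ = ψ := by
  rw [dil]
  convert symMap_id ψ
  simp

theorem dil_of_mem (r : ℝ) {n : ℕ} {ψ : Sym V} (hψ : ψ ∈ homog V n) :
    dil r ψ = (r : ℂ) ^ n • ψ := by
  induction n generalizing ψ with
  | zero =>
    refine homog_zero_induction (P := fun ψ => dil r ψ = (r : ℂ) ^ 0 • ψ) (by simp)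
      (fun c θ h => ?_) hψ
    rw [map_smul, h, smul_comm]
  | succ n ih =>
    refine homog_succ_induction (P := fun ψ => dil r ψ = (r : ℂ) ^ (n + 1) • ψ)
      (fun θ η h k => ?_) (fun v θ hθ => ?_) hψ
    · rw [map_add, h, k, smul_add]
    · rw [map_mul, dil_inc, ih hθ, smul_mul_smul_comm, pow_succ']

/-- An operator of at most linear growth in the degree is bounded after a contraction. -/
theorem exists_bound_comp_dil (L : Sym V →ₗ[ℂ] Sym V) {B r : ℝ} (hB : 0 ≤ B)
    (hL : ∀ n, ∀ ψ ∈ homog V n, ‖L ψ‖ ≤ (n + 1) * B * ‖ψ‖) (h0 : 0 ≤ r) (h1 : r < 1) :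
    ∃ K, 0 ≤ K ∧ ∀ ψ, ‖L (dil r ψ)‖ ≤ K * ‖ψ‖ := by
  have hs : Summable fun n : ℕ => r ^ n * (n + 1) := by
    have h₁ := summable_pow_mul_geometric_of_norm_lt_one 1 (r := r)
      (by rwa [Real.norm_of_nonneg h0])
    have h₂ := summable_geometric_of_lt_one h0 h1
    refine (h₁.add h₂).congr fun n => ?_
    rw [pow_one]; ring
  have hnn : ∀ n : ℕ, 0 ≤ r ^ n * (n + 1) := fun n => by positivity
  -- On degree n the contraction contributes r^n, which absorbs the growth n + 1 with a summable
  -- bound.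
  refine ⟨(∑' n : ℕ, r ^ n * (n + 1)) * B, mul_nonneg (tsum_nonneg hnn) hB, fun ψ => ?_⟩
  obtain ⟨N, hN⟩ := sum_homProj ψ
  have h₁ : L (dil r ψ) = ∑ n ∈ Finset.range N, (r : ℂ) ^ n • L (homProj n ψ) := by
    conv_lhs => rw [← hN]
    simp only [map_sum, dil_of_mem r (homProj_mem _ ψ), map_smul]
  have h₂ : ‖L (dil r ψ)‖ ≤ ∑ n ∈ Finset.range N, r ^ n * (n + 1) * (B * ‖ψ‖) := by
    rw [h₁]
    refine (norm_sum_le _ _).trans (Finset.sum_le_sum fun n _ => ?_)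
    rw [norm_smul, norm_pow, Complex.norm_real, Real.norm_of_nonneg h0, mul_assoc]
    refine mul_le_mul_of_nonneg_left ?_ (by positivity)
    refine (hL n _ (homProj_mem n ψ)).trans ?_
    rw [mul_assoc]
    have := norm_homProj_le n ψ
    gcongr
  rw [← Finset.sum_mul] at h₂
  refine h₂.trans ?_
  rw [mul_assoc]
  exact mul_le_mul_of_nonneg_right (hs.sum_le_tsum _ fun n _ => hnn n) (by positivity)

theorem exists_bound_dil {r : ℝ} (h0 : 0 ≤ r) (h1 : r < 1) :
    ∃ K, 0 ≤ K ∧ ∀ ψ : Sym V, ‖dil r ψ‖ ≤ K * ‖ψ‖ :=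
  exists_bound_comp_dil LinearMap.id zero_le_one
    (fun n ψ _ => by
      rw [mul_one, LinearMap.id_apply]
      nlinarith [norm_nonneg ψ, mul_nonneg (Nat.cast_nonneg (α := ℝ) n) (norm_nonneg ψ)]) h0 h1

theorem exists_bound_annih_dil (v : V) {r : ℝ} (h0 : 0 ≤ r) (h1 : r < 1) :
    ∃ K, 0 ≤ K ∧ ∀ ψ : Sym V, ‖annih v (dil r ψ)‖ ≤ K * ‖ψ‖ :=
  exists_bound_comp_dil (annih v).toLinearMap (norm_nonneg v) (fun n _ h => norm_annih_le n v h)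
    h0 h1

theorem exists_bound_inc_mul_dil (v : V) {r : ℝ} (h0 : 0 ≤ r) (h1 : r < 1) :
    ∃ K, 0 ≤ K ∧ ∀ ψ : Sym V, ‖inc V v * dil r ψ‖ ≤ K * ‖ψ‖ :=
  exists_bound_comp_dil (creat v) (norm_nonneg v) (fun n _ h => norm_inc_mul_le n v h) h0 h1

/-! ### Fock space as the completion of the symmetric algebra -/

open UniformSpace in
/-- The Hilbert space completion of `SV`. -/
abbrev Hil (V : Type*) [NormedAddCommGroup V] [InnerProductSpace ℂ V] : Type _ :=
  Completion (Sym V)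

/-- The inclusion of `SV` in its completion. -/
def toHil : Sym V →ₗ[ℂ] Hil V :=
  (UniformSpace.Completion.toComplₗᵢ (𝕜 := ℂ) (E := Sym V)).toLinearMap

theorem denseRange_toHil : DenseRange (toHil (V := V)) :=
  UniformSpace.Completion.denseRange_coe

@[simp]
theorem norm_toHil (ψ : Sym V) : ‖toHil ψ‖ = ‖ψ‖ := UniformSpace.Completion.norm_coe ψ

@[simp]
theorem inner_toHil (ψ φ : Sym V) : inner ℂ (toHil ψ) (toHil φ) = inner ℂ ψ φ :=
  UniformSpace.Completion.inner_coe ψ φ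

/-- The antifunctional `⟨·|h⟩`. -/
def toAnti : Hil V →ₗ[ℂ] Antidual V where
  toFun h :=
    { toFun := fun ψ => inner ℂ (toHil ψ) h
      map_add' := fun _ _ => by rw [map_add, inner_add_left]
      map_smul' := fun _ _ => by rw [map_smul, inner_smul_left, smul_eq_mul] }
  map_add' _ _ := by ext ψ; exact inner_add_right (𝕜 := ℂ) (toHil ψ) _ _
  map_smul' _ _ := by ext ψ; exact inner_smul_right (𝕜 := ℂ) (toHil ψ) _ _

theorem toAnti_apply (h : Hil V) (ψ : Sym V) : toAnti h ψ = inner ℂ (toHil ψ) h := rfl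

theorem toAnti_toHil (φ : Sym V) : toAnti (toHil φ) = embed φ := by
  ext ψ
  rw [toAnti_apply, inner_toHil]
  rfl

theorem boundedBy_iff {Φ : Antidual V} {M : ℝ} :
    BoundedBy Φ M ↔ 0 ≤ M ∧ ∀ ψ, ‖Φ ψ‖ ≤ M * ‖ψ‖ := Iff.rfl

theorem boundedBy_toAnti (h : Hil V) (M : ℝ) : BoundedBy (toAnti h) M ↔ ‖h‖ ≤ M := by
  rw [boundedBy_iff]
  constructor
  · rintro ⟨h0, hM⟩
    have key : ∀ x : Hil V, ‖inner ℂ x h‖ ≤ M * ‖x‖ := by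
      intro x
      refine denseRange_toHil.induction_on (p := fun x => ‖inner ℂ x h‖ ≤ M * ‖x‖) x
        (isClosed_le (by fun_prop) (by fun_prop)) fun ψ => ?_
      rw [norm_toHil]
      exact hM ψ
    have h₁ := key h
    rw [inner_self_eq_norm_sq_to_K] at h₁
    have h₂ : ‖h‖ ^ 2 ≤ M * ‖h‖ := by simpa using h₁
    rcases eq_or_lt_of_le (norm_nonneg h) with h | h
    · rw [← h]; exact h0
    · nlinarith
  · intro hM
    refine ⟨(norm_nonneg h).trans hM, fun ψ => ?_⟩
    rw [toAnti_apply, mul_comm, ← norm_toHil]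
    exact (norm_inner_le_norm _ _).trans (by gcongr)

theorem toAnti_mem (h : Hil V) : toAnti h ∈ fockSpace V :=
  ⟨‖h‖, (boundedBy_toAnti h _).2 le_rfl⟩

theorem toAnti_injective : Function.Injective (toAnti (V := V)) := by
  rw [injective_iff_map_eq_zero]
  intro h hh
  have : BoundedBy (toAnti h) 0 := by rw [hh]; exact ⟨le_rfl, by simp⟩
  rw [boundedBy_toAnti] at this
  exact norm_le_zero_iff.1 this

/-- Riesz representation: the conjugate of Φ is bounded and linear, so it extends to the completion.
-/
theorem exists_toAnti_eq {Φ : Antidual V} (hΦ : Φ ∈ fockSpace V) : ∃ h, toAnti h = Φ := by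
  obtain ⟨M, -, hM⟩ := hΦ
  let L : Sym V →ₗ[ℂ] ℂ :=
    { toFun := fun ψ => conj (Φ ψ)
      map_add' := fun _ _ => by simp
      map_smul' := fun _ _ => by simp }
  have hb : ∃ C, ∀ ψ, ‖L ψ‖ ≤ C * ‖toHil ψ‖ := ⟨M, fun ψ => by
    rw [norm_toHil]
    change ‖conj (Φ ψ)‖ ≤ _
    rw [RCLike.norm_conj]
    exact hM ψ⟩
  refine ⟨(InnerProductSpace.toDual ℂ (Hil V)).symm (L.extendOfNorm toHil), ?_⟩
  ext ψ
  rw [toAnti_apply, ← inner_conj_symm, InnerProductSpace.toDual_symm_apply,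
    LinearMap.extendOfNorm_eq denseRange_toHil hb]
  exact Complex.conj_conj _

/-- Fock space is the completion of `SV`. -/
def fockEquiv : Hil V ≃ₗ[ℂ] fockSpace V :=
  LinearEquiv.ofBijective (toAnti.codRestrict (fockSpace V) toAnti_mem)
    ⟨fun _ _ h => toAnti_injective (congrArg Subtype.val h), fun Φ => by
      obtain ⟨h, hh⟩ := exists_toAnti_eq Φ.2
      exact ⟨h, Subtype.ext hh⟩⟩

theorem coe_fockEquiv (h : Hil V) : (fockEquiv h : Antidual V) = toAnti h := rfl

theorem fockNorm_fockEquiv (h : Hil V) : fockNorm (fockEquiv h) = ‖h‖ := by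
  rw [fockNorm, coe_fockEquiv]
  have : {M | BoundedBy (toAnti h) M} = Set.Ici ‖h‖ := by
    ext M
    exact boundedBy_toAnti h M
  rw [this, csInf_Ici]

theorem isAntiunitary_of_hil {U : Sym V →ₗ⋆[ℂ] Antidual V} (W : Hil V →ₗ⋆[ℂ] Hil V)
    (hs : Function.Surjective W) (hn : ∀ h, ‖W h‖ = ‖h‖)
    (hU : ∀ φ, toAnti (W (toHil φ)) = U φ) : IsAntiunitary U := by
  have hi : Function.Injective W := by
    rw [injective_iff_map_eq_zero]
    intro h hh
    have := hn h
    rwa [hh, norm_zero, eq_comm, norm_eq_zero] at this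
  refine ⟨(fockEquiv (V := V)).toLinearMap.comp (W.comp (fockEquiv (V := V)).symm.toLinearMap),
    ?_, fun Φ => ?_, fun φ => ?_⟩
  · have hW : Function.Bijective W := ⟨hi, hs⟩
    exact (fockEquiv (V := V)).bijective.comp (hW.comp (fockEquiv (V := V)).symm.bijective)
  · obtain ⟨h, rfl⟩ := (fockEquiv (V := V)).surjective Φ
    simp only [LinearMap.comp_apply, LinearEquiv.coe_coe, LinearEquiv.symm_apply_apply,
      fockNorm_fockEquiv, hn]
  · have hmem : embed φ ∈ fockSpace V := by rw [← toAnti_toHil]; exact toAnti_mem _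
    have he : (⟨embed φ, hmem⟩ : fockSpace V) = fockEquiv (toHil φ) :=
      Subtype.ext (toAnti_toHil φ).symm
    refine ⟨hmem, ?_⟩
    rw [he, ← hU]
    simp only [LinearMap.comp_apply, LinearEquiv.coe_coe, LinearEquiv.symm_apply_apply,
      coe_fockEquiv]

theorem IsAntiunitary.mem_fockSpace {U : Sym V →ₗ⋆[ℂ] Antidual V} (hU : IsAntiunitary U)
    (φ : Sym V) : U φ ∈ fockSpace V := by
  obtain ⟨W, -, -, h⟩ := hU
  obtain ⟨hm, h⟩ := h φ
  rw [← h]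
  exact Subtype.property _

/-- A multiple of an isometry `SV → S[V]` extends to the completion. -/
theorem exists_extension {T : Sym V →ₗ⋆[ℂ] Hil V} {N : ℝ}
    (hT : ∀ φ, ‖T φ‖ = N * ‖φ‖) :
    ∃ W : Hil V →SL[starRingEnd ℂ] Hil V, (∀ φ, W (toHil φ) = T φ) ∧ ∀ h, ‖W h‖ = N * ‖h‖ := by
  have hb : ∃ C, ∀ φ, ‖T φ‖ ≤ C * ‖toHil φ‖ := ⟨N, fun φ => by rw [norm_toHil, hT]⟩
  have he := LinearMap.extendOfNorm_eq denseRange_toHil hb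
  refine ⟨T.extendOfNorm toHil, he, fun h => ?_⟩
  refine denseRange_toHil.induction_on (p := fun h => ‖T.extendOfNorm toHil h‖ = N * ‖h‖) h
    (isClosed_eq (by fun_prop) (by fun_prop)) fun φ => ?_
  rw [he, hT, norm_toHil]

/-- Mutually adjoint multiples of isometries are multiples of antiunitary operators. -/
theorem exists_isAntiunitary {T T' : Sym V →ₗ⋆[ℂ] Hil V} {N N' : ℝ} (hN : 0 < N) (hN' : 0 < N')
    (hT : ∀ φ, ‖T φ‖ = N * ‖φ‖) (hT' : ∀ φ, ‖T' φ‖ = N' * ‖φ‖)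
    (hadj : ∀ φ ψ, inner ℂ (toHil ψ) (T φ) = inner ℂ (toHil φ) (T' ψ))
    {U : Sym V →ₗ⋆[ℂ] Antidual V} (hU : ∀ φ, toAnti (T φ) = U φ) :
    ∃ c : ℂ, c ≠ 0 ∧ IsAntiunitary (c • U) := by
  obtain ⟨W, hW, hWn⟩ := exists_extension hT
  obtain ⟨W', hW', hWn'⟩ := exists_extension hT'
  have hadj' : ∀ φ h, inner ℂ h (W (toHil φ)) = inner ℂ (toHil φ) (W' h) := by
    intro φ h
    refine denseRange_toHil.induction_on
      (p := fun h => inner ℂ h (W (toHil φ)) = inner ℂ (toHil φ) (W' h)) h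
      (isClosed_eq (by fun_prop) (by fun_prop)) fun ψ => ?_
    rw [hW, hW', hadj]
  have hNc : ((N⁻¹ : ℝ) : ℂ) ≠ 0 := by exact_mod_cast (inv_pos.2 hN).ne'
  have hsurj : Function.Surjective W := by
    rw [← ContinuousLinearMap.coe_coe, ← LinearMap.range_eq_top]
    have hanti : AntilipschitzWith (Real.toNNReal N⁻¹) W :=
      AddMonoidHomClass.antilipschitz_of_bound W fun h => by
        rw [hWn, Real.coe_toNNReal _ (inv_nonneg.2 hN.le), inv_mul_cancel_left₀ hN.ne']
    have hclosed : IsClosed (LinearMap.range (W : Hil V →ₗ⋆[ℂ] Hil V) : Set (Hil V)) := by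
      rw [LinearMap.coe_range]
      exact hanti.isClosed_range W.uniformContinuous
    have := hclosed.completeSpace_coe
    rw [← Submodule.orthogonal_eq_bot_iff, Submodule.eq_bot_iff]
    intro h hh
    rw [Submodule.mem_orthogonal'] at hh
    -- The adjoint kills the orthogonal complement of the range, and being a nonzero multiple of an
    -- isometry it is injective.
    have h0 : W' h = 0 := by
      refine toAnti_injective ?_
      ext φ
      rw [toAnti_apply, ← hadj', map_zero]
      exact hh _ ⟨_, rfl⟩
    have h₁ := hWn' h
    rw [h0, norm_zero, eq_comm, mul_eq_zero] at h₁
    exact norm_eq_zero.1 (h₁.resolve_left hN'.ne')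
  refine ⟨((N⁻¹ : ℝ) : ℂ), hNc,
    isAntiunitary_of_hil (((N⁻¹ : ℝ) : ℂ) • (W : Hil V →ₗ⋆[ℂ] Hil V)) (fun h => ?_) (fun h => ?_)
      fun φ => ?_⟩
  · obtain ⟨x, hx⟩ := hsurj ((((N⁻¹ : ℝ) : ℂ))⁻¹ • h)
    refine ⟨x, ?_⟩
    rw [LinearMap.smul_apply, ContinuousLinearMap.coe_coe, hx, smul_inv_smul₀ hNc]
  · rw [LinearMap.smul_apply, ContinuousLinearMap.coe_coe, norm_smul, hWn, Complex.norm_real,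
      Real.norm_of_nonneg (inv_nonneg.2 hN.le), inv_mul_cancel_left₀ hN.ne']
  · rw [LinearMap.smul_apply, ContinuousLinearMap.coe_coe, hW, map_smul, hU, LinearMap.smul_apply]

/-! ### Hilbert-Schmidt bounds -/

/-- `∑ₖ ‖T eₖ‖² ≤ h` for all finite orthonormal families `(eₖ)`. -/
def HSBound (T : V → V) (h : ℝ) : Prop :=
  ∀ (n : ℕ) (e : Fin n → V), Orthonormal ℂ e → ∑ k, ‖T (e k)‖ ^ 2 ≤ h

theorem HSBound.sum_le {T : V → V} {h : ℝ} (hT : HSBound T h) {ι : Type*} [Fintype ι] {e : ι → V}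
    (he : Orthonormal ℂ e) : ∑ k, ‖T (e k)‖ ^ 2 ≤ h := by
  have := hT _ _ (he.comp _ (Fintype.equivFin ι).symm.injective)
  rwa [← Equiv.sum_comp (Fintype.equivFin ι).symm]

theorem HSBound.sum_finset_le {T : V → V} {h : ℝ} (hT : HSBound T h) {ι : Type*} {e : ι → V}
    (he : Orthonormal ℂ e) (s : Finset ι) : ∑ k ∈ s, ‖T (e k)‖ ^ 2 ≤ h := by
  have := hT.sum_le (he.comp (Subtype.val : s → ι) Subtype.val_injective)
  rwa [← Finset.sum_coe_sort s fun k => ‖T (e k)‖ ^ 2]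

theorem HSBound.of_norm_le {T S : V → V} {h K : ℝ} (hT : HSBound T h)
    (hS : ∀ v, ‖S v‖ ≤ K * ‖T v‖) : HSBound S (K ^ 2 * h) := fun n e he => by
  refine le_trans ?_ (mul_le_mul_of_nonneg_left (hT n e he) (sq_nonneg K))
  rw [Finset.mul_sum]
  refine Finset.sum_le_sum fun k _ => ?_
  rw [← mul_pow]
  exact pow_le_pow_left₀ (norm_nonneg _) (hS _) 2

theorem hasSum_sq_norm_inner {κ : Type*} (b : HilbertBasis κ ℂ V) (x : V) :
    HasSum (fun j => ‖inner ℂ (b j) x‖ ^ 2) (‖x‖ ^ 2) := by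
  have h := Complex.hasSum_re (b.hasSum_inner_mul_inner x x)
  rw [inner_self_eq_norm_sq_to_K] at h
  convert h using 1
  · ext j
    rw [← inner_conj_symm x, mul_comm, Complex.mul_conj, Complex.normSq_eq_norm_sq]
    norm_cast
  · norm_cast

/-- A Hilbert-Schmidt bound of the adjoint on one Hilbert basis suffices. -/
theorem hsBound_of_adjoint {T T' : V → V} (hadj : ∀ x y, ‖inner ℂ x (T y)‖ = ‖inner ℂ y (T' x)‖)
    {κ : Type*} (b : HilbertBasis κ ℂ V) {h : ℝ}
    (hb : ∀ s : Finset κ, ∑ j ∈ s, ‖T' (b j)‖ ^ 2 ≤ h) : HSBound T h := by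
  intro n e he
  -- Parseval in b, exchange of the sums, then Bessel for e after passing to the adjoint.
  have hs : HasSum (fun j => ∑ k, ‖inner ℂ (b j) (T (e k))‖ ^ 2) (∑ k, ‖T (e k)‖ ^ 2) :=
    hasSum_sum fun k _ => hasSum_sq_norm_inner b (T (e k))
  refine le_of_tendsto' hs fun s => (Finset.sum_le_sum fun j _ => ?_).trans (hb s)
  simp only [hadj]
  exact he.sum_inner_products_le _

theorem HSBound.adjoint [CompleteSpace V] {T T' : V → V}
    (hadj : ∀ x y, ‖inner ℂ x (T y)‖ = ‖inner ℂ y (T' x)‖) {h : ℝ} (hT : HSBound T' h) :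
    HSBound T h := by
  obtain ⟨w, b, -⟩ := exists_hilbertBasis ℂ V
  exact hsBound_of_adjoint hadj b fun s => hT.sum_finset_le b.orthonormal s

theorem IsHilbertSchmidt.exists_hsBound_adjoint {T : V →ₗ[ℂ] V} {T' : V → V}
    (hadj : ∀ x y, ‖inner ℂ x (T' y)‖ = ‖inner ℂ y (T x)‖) (hT : IsHilbertSchmidt T) :
    ∃ h, HSBound T' h := by
  obtain ⟨-, w, b, hb⟩ := hT
  exact ⟨_, hsBound_of_adjoint hadj b fun s => hb.sum_le_tsum s fun _ _ => by positivity⟩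

theorem HSBound.isHilbertSchmidt [CompleteSpace V] {T : V →ₗ[ℂ] V} (hc : Continuous T) {h : ℝ}
    (hT : HSBound T h) : IsHilbertSchmidt T := by
  obtain ⟨w, b, -⟩ := exists_hilbertBasis ℂ V
  exact ⟨hc, w, b, summable_of_sum_le (fun _ => by positivity)
    fun s => hT.sum_finset_le b.orthonormal s⟩

theorem IsHilbertSchmidt.smul {T : V →ₗ[ℂ] V} (hT : IsHilbertSchmidt T) (c : ℂ) :
    IsHilbertSchmidt (c • T) := by
  obtain ⟨hc, w, b, hb⟩ := hT
  refine ⟨hc.const_smul c, w, b, (hb.mul_left (‖c‖ ^ 2)).congr fun k => ?_⟩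
  rw [LinearMap.smul_apply, norm_smul, mul_pow]

/-! ### Gaussians in Fock space -/

/-- A bounded Gaussian has a Hilbert-Schmidt exponent. -/
theorem IsGaussianLike.hsBound {Z : V →ₗ⋆[ℂ] V} (hZ : IsSymmetricAnti Z) {u : Antidual V}
    (h1 : u 1 = 1) (hu : IsGaussianLike Z u) {M : ℝ} (hM : BoundedBy u M) :
    HSBound Z (2 * M ^ 2) := by
  intro n e he
  set S := ∑ k, ‖Z (e k)‖ ^ 2 with hS
  have hS0 : 0 ≤ S := Finset.sum_nonneg fun _ _ => by positivity
  -- A test vector with u(ψ) = S and ‖ψ‖² ≤ 2S, so boundedness gives S² ≤ 2M²S.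
  set ψ : Sym V := ∑ k, inc V (e k) * inc V (Z (e k)) with hψ
  have huψ : u ψ = (S : ℂ) := by
    rw [hψ, map_sum, hS]
    push_cast
    refine Finset.sum_congr rfl fun k _ => ?_
    rw [hu, annih_inc, Algebra.algebraMap_eq_smul_one, map_smulₛₗ, h1, inner_conj_symm,
      inner_self_eq_norm_sq_to_K, smul_eq_mul, mul_one]
    rfl
  have hterm : ∀ k l, inner ℂ (inc V (e k) * inc V (Z (e k))) (inc V (e l) * inc V (Z (e l))) =
      (if l = k then ((‖Z (e k)‖ ^ 2 : ℝ) : ℂ) else 0) +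
        ((‖inner ℂ (e k) (Z (e l))‖ ^ 2 : ℝ) : ℂ) := by
    intro k l
    have hinc : ∀ x y : V, inner ℂ (inc V x) (inc V y) = inner ℂ x y := fun x y => by
      have := inner_inc_mul_right y (inc V x) 1
      rw [mul_one, annih_inc] at this
      rw [this, Algebra.algebraMap_eq_smul_one, inner_smul_left, inner_conj_symm,
        inner_self_eq_norm_sq_to_K, norm_one_sym]
      simp
    rw [inner_inc_mul_right, annih_inc_mul, annih_inc, ← Algebra.commutes, ← Algebra.smul_def,
      inner_add_left, inner_smul_left, inner_smul_left, hinc, hinc, orthonormal_iff_ite.1 he,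
      hZ (e k) (e l), mul_comm (conj (inner ℂ (e k) (Z (e l)))), Complex.mul_conj,
      Complex.normSq_eq_norm_sq]
    congr 1
    split_ifs with h
    · subst h
      rw [inner_self_eq_norm_sq_to_K]
      simp
    · simp
  have hnorm : ‖ψ‖ ^ 2 ≤ 2 * S := by
    have h₁ : inner ℂ ψ ψ = ((S + ∑ k, ∑ l, ‖inner ℂ (e k) (Z (e l))‖ ^ 2 : ℝ) : ℂ) := by
      rw [hψ, sum_inner]
      simp only [inner_sum, hterm, Finset.sum_add_distrib, Finset.sum_ite_eq', Finset.mem_univ,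
        if_true]
      rw [hS]
      push_cast
      rfl
    have h₂ : ‖ψ‖ ^ 2 = S + ∑ k, ∑ l, ‖inner ℂ (e k) (Z (e l))‖ ^ 2 := by
      rw [← inner_self_eq_norm_sq (𝕜 := ℂ), h₁]
      exact Complex.ofReal_re _
    have h₃ : ∑ k, ∑ l, ‖inner ℂ (e k) (Z (e l))‖ ^ 2 ≤ S := by
      rw [Finset.sum_comm, hS]
      exact Finset.sum_le_sum fun l _ => he.sum_inner_products_le _
    linarith
  have hb := hM.2 ψ
  rw [huψ, sqrt_innerS_self, Complex.norm_real, Real.norm_of_nonneg hS0] at hb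
  have hb2 : S ^ 2 ≤ M ^ 2 * (2 * S) := by
    calc S ^ 2 ≤ (M * ‖ψ‖) ^ 2 := pow_le_pow_left₀ hS0 hb 2
      _ = M ^ 2 * ‖ψ‖ ^ 2 := mul_pow _ _ _
      _ ≤ _ := by gcongr
  rcases eq_or_lt_of_le hS0 with h | h
  · rw [← h]; positivity
  · nlinarith

/-- The bounds of the squared norms of the homogeneous parts of a Gaussian. -/
def gaussBound (h κ : ℝ) : ℕ → ℝ
  | 0 => 1
  | n + 1 => (h + 2 * n * κ ^ 2) / (2 * (n + 1)) * gaussBound h κ n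

theorem gaussBound_nonneg {h κ : ℝ} (hh : 0 ≤ h) (n : ℕ) : 0 ≤ gaussBound h κ n := by
  induction n with
  | zero => exact zero_le_one
  | succ n ih => rw [gaussBound]; positivity

theorem summable_gaussBound {h κ : ℝ} (hh : 0 ≤ h) (h0 : 0 ≤ κ) (h1 : κ < 1) :
    Summable (gaussBound h κ) := by
  have hκ : κ ^ 2 < 1 := by nlinarith
  -- The ratios tend to κ² < 1; the midpoint between κ² and 1 bounds them once n exceeds h/(1 - κ²).
  refine summable_of_ratio_norm_eventually_le (r := (1 + κ ^ 2) / 2) (by linarith) ?_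
  obtain ⟨N, hN⟩ := exists_nat_gt (h / (1 - κ ^ 2))
  filter_upwards [Filter.eventually_ge_atTop N] with n hn
  have hn' : h / (1 - κ ^ 2) < n := hN.trans_le (by exact_mod_cast hn)
  rw [div_lt_iff₀ (by linarith)] at hn'
  rw [Real.norm_of_nonneg (gaussBound_nonneg hh _), Real.norm_of_nonneg (gaussBound_nonneg hh _),
    gaussBound]
  refine mul_le_mul_of_nonneg_right ?_ (gaussBound_nonneg hh n)
  rw [div_le_div_iff₀ (by positivity) (by positivity)]
  nlinarith

theorem norm_sq_homog {ι : Type*} [Fintype ι] (e : OrthonormalBasis ι ℂ V) {n : ℕ}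
    {ψ : Sym V} (hψ : ψ ∈ homog V n) : (n : ℝ) * ‖ψ‖ ^ 2 = ∑ k, ‖annih (e k) ψ‖ ^ 2 := by
  have h := congrArg Complex.re (innerS_self_homog e hψ)
  rw [← Complex.ofReal_natCast, Complex.re_ofReal_mul, Complex.re_sum] at h
  simp only [← inner_self_eq_norm_sq (𝕜 := ℂ)]
  exact h

/-- The Hilbert–Schmidt norm of FZ is at most κ times that of F. Each coordinate of F is v ↦ ⟨v|w⟩
for some vector w, and symmetry moves Z onto w. -/
theorem sum_norm_comp_sq_le {ι : Type*} [Fintype ι] (e : OrthonormalBasis ι ℂ V)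
    {E : Type*} [NormedAddCommGroup E] [InnerProductSpace ℂ E] (F : V →ₗ⋆[ℂ] E)
    {Z : V →ₗ⋆[ℂ] V} (hZ : IsSymmetricAnti Z) {κ : ℝ} (hκ : ∀ v, ‖Z v‖ ≤ κ * ‖v‖) :
    ∑ k, ‖F (Z (e k))‖ ^ 2 ≤ κ ^ 2 * ∑ k, ‖F (e k)‖ ^ 2 := by
  let R : Submodule ℂ E := Submodule.span ℂ (Set.range fun k => F (e k))
  have : FiniteDimensional ℂ R := FiniteDimensional.span_of_finite ℂ (Set.finite_range _)
  let f := stdOrthonormalBasis ℂ R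
  have hexp : ∀ v, F v = ∑ k, inner ℂ v (e k) • F (e k) := by
    intro v
    conv_lhs => rw [← e.sum_repr' v]
    simp [map_sum, map_smulₛₗ]
  have hmem : ∀ v, F v ∈ R := fun v => by
    rw [hexp]
    exact Submodule.sum_mem _ fun k _ =>
      Submodule.smul_mem _ _ (Submodule.subset_span ⟨k, rfl⟩)
  have hnorm : ∀ v, ‖F v‖ ^ 2 = ∑ m, ‖inner ℂ (f m : E) (F v)‖ ^ 2 := fun v =>
    (f.sum_sq_norm_inner_right ⟨F v, hmem v⟩).symm
  simp only [hnorm]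
  rw [Finset.sum_comm, Finset.sum_comm (s := Finset.univ) (t := Finset.univ)
    (f := fun k m => ‖inner ℂ (f m : E) (F (e k))‖ ^ 2), Finset.mul_sum]
  refine Finset.sum_le_sum fun m _ => ?_
  set w : V := ∑ k, inner ℂ (f m : E) (F (e k)) • e k with hw
  have hwF : ∀ v, inner ℂ (f m : E) (F v) = inner ℂ v w := by
    intro v
    rw [hexp, hw, inner_sum, inner_sum]
    refine Finset.sum_congr rfl fun k _ => ?_
    rw [inner_smul_right, inner_smul_right, mul_comm]
  simp only [hwF]
  rw [e.sum_sq_norm_inner_right]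
  calc ∑ k, ‖inner ℂ (Z (e k)) w‖ ^ 2 = ∑ k, ‖inner ℂ (e k) (Z w)‖ ^ 2 := by
        refine Finset.sum_congr rfl fun k _ => ?_
        rw [norm_inner_symm, hZ]
    _ = ‖Z w‖ ^ 2 := e.sum_sq_norm_inner_right _
    _ ≤ (κ * ‖w‖) ^ 2 := pow_le_pow_left₀ (norm_nonneg _) (hκ w) 2
    _ = _ := mul_pow _ _ _

/-! ### Gaussians over a finite-dimensional space -/

section finite

variable {ι : Type*} [Fintype ι] (e : OrthonormalBasis ι ℂ V) (Z : V →ₗ⋆[ℂ] V)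

/-- The quadratic of `Z` as an element of the symmetric algebra of a finite-dimensional space. -/
def quad : Sym V := (2⁻¹ : ℂ) • ∑ k, inc V (e k) * inc V (Z (e k))

/-- The homogeneous part of degree `2n` of the Gaussian in finite dimensions. -/
def gaussPart (n : ℕ) : Sym V := ((n.factorial : ℂ))⁻¹ • quad e Z ^ n

theorem quad_mem : quad e Z ∈ homog V 2 := by
  refine Submodule.smul_mem _ _ (Submodule.sum_mem _ fun k _ => inc_mul_mem_homog _ ?_)
  simpa using inc_mul_mem_homog (Z (e k)) one_mem_homog

theorem gaussPart_mem (n : ℕ) : gaussPart e Z n ∈ homog V (2 * n) := by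
  refine Submodule.smul_mem _ _ ?_
  rw [homog, pow_mul]
  exact Submodule.pow_mem_pow _ (quad_mem e Z) n

variable {Z}

/-- By symmetry the two Leibniz terms are equal, which the factor 1/2 compensates. -/
theorem annih_quad (hZ : IsSymmetricAnti Z) (v : V) : annih v (quad e Z) = inc V (Z v) := by
  have h₁ : ∑ k, inner ℂ v (e k) • inc V (Z (e k)) = inc V (Z v) := by
    conv_rhs => rw [← e.sum_repr' v]
    simp [map_sum, map_smulₛₗ]
  have h₂ : ∑ k, inner ℂ v (Z (e k)) • inc V (e k) = inc V (Z v) := by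
    conv_rhs => rw [← e.sum_repr' (Z v)]
    simp only [map_sum, map_smul]
    exact Finset.sum_congr rfl fun k _ => by rw [hZ]
  rw [quad, Derivation.map_smul, map_sum]
  simp only [annih_inc_mul, annih_inc, ← Algebra.commutes, ← Algebra.smul_def,
    Finset.sum_add_distrib, h₁, h₂]
  module

theorem annih_gaussPart (hZ : IsSymmetricAnti Z) (v : V) (n : ℕ) :
    annih v (gaussPart e Z (n + 1)) = inc V (Z v) * gaussPart e Z n := by
  have : (n : ℂ) + 1 ≠ 0 := by exact_mod_cast n.succ_ne_zero
  rw [gaussPart, Derivation.map_smul, Derivation.leibniz_pow, annih_quad e hZ, gaussPart,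
    Nat.add_sub_cancel, smul_eq_mul, mul_comm (quad e Z ^ n), ← Nat.cast_smul_eq_nsmul ℂ, smul_smul,
    mul_smul_comm, Nat.factorial_succ]
  congr 1
  push_cast
  field_simp

/-- With G_n the part of degree 2n, the number operator gives 2(n+1)‖G_{n+1}‖² = ∑‖Ze_k · G_n‖². The
commutation relation splits this into ∑‖Ze_k‖²‖G_n‖² and ∑‖a(Ze_k)G_n‖², and the latter is at most
κ² · 2n‖G_n‖². -/
theorem norm_gaussPart_sq_le (hZ : IsSymmetricAnti Z) {κ h : ℝ}
    (hκ : ∀ v, ‖Z v‖ ≤ κ * ‖v‖) (hh : ∑ k, ‖Z (e k)‖ ^ 2 ≤ h) (n : ℕ) :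
    ‖gaussPart e Z n‖ ^ 2 ≤ gaussBound h κ n := by
  have hh0 : 0 ≤ h := le_trans (Finset.sum_nonneg fun _ _ => by positivity) hh
  induction n with
  | zero => simp [gaussPart, gaussBound, norm_one_sym]
  | succ n ih =>
    let F : V →ₗ⋆[ℂ] Sym V :=
      { toFun := fun v => annih v (gaussPart e Z n)
        map_add' := fun v w => by rw [annih_add]; rfl
        map_smul' := fun c v => by rw [annih_smul]; rfl }
    have h₁ := norm_sq_homog e (gaussPart_mem e Z (n + 1))
    simp only [annih_gaussPart e hZ, norm_inc_mul_sq, Finset.sum_add_distrib,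
      ← Finset.sum_mul] at h₁
    have h₂ : ∑ k, ‖annih (Z (e k)) (gaussPart e Z n)‖ ^ 2 ≤
        κ ^ 2 * ∑ k, ‖annih (e k) (gaussPart e Z n)‖ ^ 2 := sum_norm_comp_sq_le e F hZ hκ
    rw [← norm_sq_homog e (gaussPart_mem e Z n)] at h₂
    have h₃ : (∑ k, ‖Z (e k)‖ ^ 2) * ‖gaussPart e Z n‖ ^ 2 ≤ h * ‖gaussPart e Z n‖ ^ 2 := by
      gcongr
    push_cast at h₁ h₂
    have h₄ : (2 * ((n : ℝ) + 1)) * ‖gaussPart e Z (n + 1)‖ ^ 2 ≤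
        (h + 2 * n * κ ^ 2) * ‖gaussPart e Z n‖ ^ 2 := by
      rw [h₁]; linarith
    rw [gaussBound, div_mul_eq_mul_div, le_div_iff₀ (by positivity), mul_comm]
    exact h₄.trans (by gcongr)

theorem norm_sum_gaussPart_sq (m : ℕ) :
    ‖∑ n ∈ Finset.range m, gaussPart e Z n‖ ^ 2 = ∑ n ∈ Finset.range m, ‖gaussPart e Z n‖ ^ 2 := by
  induction m with
  | zero => simp
  | succ m ih =>
    rw [Finset.sum_range_succ, Finset.sum_range_succ, ← ih]
    have h0 : inner ℂ (∑ n ∈ Finset.range m, gaussPart e Z n) (gaussPart e Z m) = 0 := by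
      rw [sum_inner]
      refine Finset.sum_eq_zero fun n hn => ?_
      rw [Finset.mem_range] at hn
      exact innerS_eq_zero_of_ne (by omega) (gaussPart_mem e Z n) (gaussPart_mem e Z m)
    have := norm_add_sq_eq_norm_sq_add_norm_sq_of_inner_eq_zero _ _ h0
    simpa [sq] using this

theorem IsGaussianLike.hasSum_inner_gaussPart (hZ : IsSymmetricAnti Z) {u : Antidual V}
    (h1 : u 1 = 1) (hu : IsGaussianLike Z u) (ψ : Sym V) :
    HasSum (fun n => inner ℂ ψ (gaussPart e Z n)) (u ψ) := by
  induction ψ using degree_induction with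
  | one =>
    have hz : ∀ n : ℕ, n ≠ 0 → inner ℂ (1 : Sym V) (gaussPart e Z n) = 0 := fun n hn =>
      innerS_eq_zero_of_ne (by omega) one_mem_homog (gaussPart_mem e Z n)
    have := hasSum_single (f := fun n => inner ℂ (1 : Sym V) (gaussPart e Z n)) 0 hz
    rw [h1]
    simpa [gaussPart, inner_self_eq_norm_sq_to_K, norm_one_sym] using this
  | smul c θ h =>
    simpa [inner_smul_left, mul_comm] using h.mul_left (conj c)
  | add θ η h k =>
    simpa [inner_add_left] using h.add k
  | cons n v ψ hψ ih =>
    have key := annih_of_le (P := fun ψ => HasSum (fun n => inner ℂ ψ (gaussPart e Z n)) (u ψ))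
      (by simp) ih (Z v) hψ
    rw [hu, ← hasSum_nat_add_iff' 1]
    have hzero : inner ℂ (inc V v * ψ) (gaussPart e Z 0) = 0 := by
      rw [inner_inc_mul_left]; simp [gaussPart]
    simp only [Finset.sum_range_one, hzero, sub_zero]
    refine key.congr_fun fun m => ?_
    rw [inner_inc_mul_left, annih_gaussPart e hZ, inner_inc_mul_right]

theorem IsGaussianLike.norm_le_of_basis (hZ : IsSymmetricAnti Z) {κ h : ℝ} (h0 : 0 ≤ κ)
    (hκ1 : κ < 1) (hκ : ∀ v, ‖Z v‖ ≤ κ * ‖v‖) (hh : ∑ k, ‖Z (e k)‖ ^ 2 ≤ h)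
    {u : Antidual V} (h1 : u 1 = 1) (hu : IsGaussianLike Z u) (ψ : Sym V) :
    ‖u ψ‖ ≤ √(∑' n, gaussBound h κ n) * ‖ψ‖ := by
  have hh0 : 0 ≤ h := le_trans (Finset.sum_nonneg fun _ _ => by positivity) hh
  have ht := (IsGaussianLike.hasSum_inner_gaussPart e hZ h1 hu ψ).tendsto_sum_nat.norm
  refine le_of_tendsto' ht fun m => ?_
  rw [← inner_sum, mul_comm]
  refine (norm_inner_le_norm _ _).trans (mul_le_mul_of_nonneg_left ?_ (norm_nonneg _))
  refine Real.le_sqrt_of_sq_le ?_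
  rw [norm_sum_gaussPart_sq]
  exact (Finset.sum_le_sum fun n _ => norm_gaussPart_sq_le e hZ hκ hh n).trans
    ((summable_gaussBound hh0 h0 hκ1).sum_le_tsum _ fun n _ => gaussBound_nonneg hh0 n)

end finite

/-- A Gaussian whose exponent is Hilbert-Schmidt of norm less than one lies in Fock space. -/
theorem IsGaussianLike.mem_fockSpace {Z : V →ₗ⋆[ℂ] V} (hZ : IsSymmetricAnti Z) {κ h : ℝ}
    (h0 : 0 ≤ κ) (hκ1 : κ < 1) (hκ : ∀ v, ‖Z v‖ ≤ κ * ‖v‖) (hh : HSBound Z h) {u : Antidual V}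
    (h1 : u 1 = 1) (hu : IsGaussianLike Z u) : u ∈ fockSpace V := by
  refine ⟨√(∑' n, gaussBound h κ n), Real.sqrt_nonneg _, fun ψ => ?_⟩
  rw [sqrt_innerS_self]
  obtain ⟨F, hF, η, rfl⟩ := exists_finiteDimensional ψ
  have hn : ‖symMap F.subtype η‖ = ‖η‖ := by
    rw [← sqrt_innerS_self, innerS_symMap_subtype, sqrt_innerS_self]
  rw [hn]
  let P : V →ₗ[ℂ] F := F.orthogonalProjectionOnto.toLinearMap
  have hP : ∀ v (w : F), inner ℂ v (F.subtype w) = inner ℂ (P v) w := fun v w => by simp [P]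
  have hPn : ∀ v, ‖P v‖ ≤ ‖v‖ := fun v => F.norm_orthogonalProjectionOnto_apply_le v
  -- On SF the functional u is the Gaussian of the compression of Z. Compression increases neither h
  -- nor κ, so the bound is independent of F.
  let ZF : F →ₗ⋆[ℂ] F := P.comp (Z.comp F.subtype)
  have hZF : ∀ w : F, ZF w = P (Z w) := fun _ => rfl
  let uF : Antidual F := u.comp (symMap F.subtype).toLinearMap
  have huF : ∀ θ, uF θ = u (symMap F.subtype θ) := fun _ => rfl
  have hinner : ∀ x y : F, inner ℂ y (ZF x) = inner ℂ (y : V) (Z x) := fun x y => by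
    rw [hZF, ← inner_conj_symm, ← hP, inner_conj_symm]
    rfl
  let e := stdOrthonormalBasis ℂ F
  rw [← huF]
  refine IsGaussianLike.norm_le_of_basis e (Z := ZF) (fun x y => ?_) h0 hκ1 (fun v => ?_) ?_ ?_ ?_ η
  · rw [hinner, hinner, hZ]
  · exact (hPn _).trans (hκ v)
  · have he : Orthonormal ℂ fun k => (e k : V) := e.orthonormal.comp_linearIsometry F.subtypeₗᵢ
    refine (Finset.sum_le_sum fun k _ => ?_).trans (hh.sum_le he)
    exact pow_le_pow_left₀ (norm_nonneg _) (hPn _) 2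
  · rw [huF, map_one, h1]
  · intro v θ
    rw [huF, map_mul, symMap_inc, hu, annih_symMap F.subtype hP]
    rfl

/-! ### Regular antifunctionals -/

/-- `Φ` stays in Fock space under some dilation `t^N` with `t > 1`. -/
def Reg (Φ : Antidual V) : Prop :=
  ∃ t : ℝ, 1 < t ∧ Φ.comp (dil t).toLinearMap ∈ fockSpace V

theorem mem_fockSpace_iff {Φ : Antidual V} :
    Φ ∈ fockSpace V ↔ ∃ M, 0 ≤ M ∧ ∀ ψ, ‖Φ ψ‖ ≤ M * ‖ψ‖ := Iff.rfl

theorem mem_fockSpace_of_comp {Φ Ψ : Antidual V} (hΦ : Φ ∈ fockSpace V) {L : Sym V → Sym V}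
    (hL : ∃ K, 0 ≤ K ∧ ∀ ψ, ‖L ψ‖ ≤ K * ‖ψ‖) {c : ℝ} (h : ∀ ψ, ‖Ψ ψ‖ ≤ c * ‖Φ (L ψ)‖) :
    Ψ ∈ fockSpace V := by
  obtain ⟨M, hM0, hM⟩ := mem_fockSpace_iff.1 hΦ
  obtain ⟨K, hK0, hK⟩ := hL
  refine mem_fockSpace_iff.2 ⟨|c| * (M * K), by positivity, fun ψ => ?_⟩
  calc ‖Ψ ψ‖ ≤ c * ‖Φ (L ψ)‖ := h ψ
    _ ≤ |c| * ‖Φ (L ψ)‖ := by gcongr; exact le_abs_self c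
    _ ≤ |c| * (M * (K * ‖ψ‖)) := by
        gcongr
        exact (hM _).trans (by gcongr; exact hK ψ)
    _ = _ := by ring

theorem mem_fockSpace_dil_mono {Φ : Antidual V} {s t : ℝ} (hs : 0 ≤ s) (hst : s < t)
    (h : Φ.comp (dil t).toLinearMap ∈ fockSpace V) : Φ.comp (dil s).toLinearMap ∈ fockSpace V := by
  have ht : 0 < t := hs.trans_lt hst
  refine mem_fockSpace_of_comp h (L := dil (s / t))
    (exists_bound_dil (by positivity) ((div_lt_one ht).2 hst)) (c := 1) fun ψ => ?_
  rw [one_mul]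
  change ‖Φ (dil s ψ)‖ ≤ ‖Φ (dil t (dil (s / t) ψ))‖
  rw [dil_dil, mul_div_cancel₀ _ ht.ne']

theorem Reg.add {Φ Ψ : Antidual V} (hΦ : Reg Φ) (hΨ : Reg Ψ) : Reg (Φ + Ψ) := by
  obtain ⟨s, hs, h⟩ := hΦ
  obtain ⟨t, ht, k⟩ := hΨ
  obtain ⟨r, hr, hr'⟩ := exists_between (lt_min hs ht)
  refine ⟨r, hr, ?_⟩
  rw [LinearMap.add_comp]
  exact Submodule.add_mem _
    (mem_fockSpace_dil_mono (by linarith) (hr'.trans_le (min_le_left _ _)) h)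
    (mem_fockSpace_dil_mono (by linarith) (hr'.trans_le (min_le_right _ _)) k)

theorem Reg.smul {Φ : Antidual V} (hΦ : Reg Φ) (c : ℂ) : Reg (c • Φ) := by
  obtain ⟨s, hs, h⟩ := hΦ
  exact ⟨s, hs, Submodule.smul_mem _ c h⟩

/-- Giving up part of the margin, from t to s, leaves a factor (s/t)^N that makes the unbounded
annihilator bounded. -/
theorem Reg.creat' {Φ : Antidual V} (hΦ : Reg Φ) (v : V) : Reg (creat' v Φ) := by
  obtain ⟨t, ht, h⟩ := hΦ
  obtain ⟨s, hs, hst⟩ := exists_between ht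
  have ht0 : 0 < t := by linarith
  refine ⟨s, hs, mem_fockSpace_of_comp h (L := fun ψ => annih v (dil (s / t) ψ))
    (exists_bound_annih_dil v (by positivity) ((div_lt_one ht0).2 hst)) (c := t) fun ψ => ?_⟩
  change ‖Φ (annih v (dil s ψ))‖ ≤ t * ‖Φ (dil t (annih v (dil (s / t) ψ)))‖
  have h₁ := annih_dil t v (dil (s / t) ψ)
  rw [dil_dil, mul_div_cancel₀ _ ht0.ne'] at h₁
  rw [h₁, map_smulₛₗ, norm_smul, RCLike.norm_conj, Complex.norm_real, Real.norm_of_nonneg ht0.le]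

theorem Reg.annih' {Φ : Antidual V} (hΦ : Reg Φ) (v : V) : Reg (annih' v Φ) := by
  obtain ⟨t, ht, h⟩ := hΦ
  obtain ⟨s, hs, hst⟩ := exists_between ht
  have ht0 : 0 < t := by linarith
  refine ⟨s, hs, mem_fockSpace_of_comp h (L := fun ψ => inc V v * dil (s / t) ψ)
    (exists_bound_inc_mul_dil v (by positivity) ((div_lt_one ht0).2 hst)) (c := t⁻¹) fun ψ => ?_⟩
  change ‖Φ (inc V v * dil s ψ)‖ ≤ t⁻¹ * ‖Φ (dil t (inc V v * dil (s / t) ψ))‖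
  rw [map_mul (dil t), dil_inc, dil_dil, mul_div_cancel₀ _ ht0.ne', smul_mul_assoc, map_smulₛₗ,
    norm_smul, RCLike.norm_conj, Complex.norm_real, Real.norm_of_nonneg ht0.le,
    inv_mul_cancel_left₀ ht0.ne']

theorem exists_tendsto_of_bound (B : Sym V →ₗ[ℂ] Sym V) (hB : ∃ K, 0 ≤ K ∧ ∀ ψ, ‖B ψ‖ ≤ K * ‖ψ‖)
    {κ : ℕ → Sym V} {k : Hil V} (hκ : Filter.Tendsto (fun m => toHil (κ m)) Filter.atTop (nhds k)) :
    ∃ h, Filter.Tendsto (fun m => toHil (B (κ m))) Filter.atTop (nhds h) := by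
  obtain ⟨K, -, hK⟩ := hB
  have hb : ∃ C, ∀ ψ, ‖(toHil ∘ₗ B) ψ‖ ≤ C * ‖toHil ψ‖ := ⟨K, fun ψ => by
    rw [LinearMap.comp_apply, norm_toHil, norm_toHil]; exact hK ψ⟩
  refine ⟨(toHil ∘ₗ B).extendOfNorm toHil k, ?_⟩
  have := (((toHil ∘ₗ B).extendOfNorm toHil).continuous.tendsto k).comp hκ
  refine this.congr fun m => ?_
  exact LinearMap.extendOfNorm_eq denseRange_toHil hb (κ m)

theorem toAnti_eq_of_tendsto {x : ℕ → Sym V} {h : Hil V} {Ψ : Antidual V}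
    (hx : Filter.Tendsto (fun m => toHil (x m)) Filter.atTop (nhds h))
    (hw : ∀ ψ, Filter.Tendsto (fun m => inner ℂ ψ (x m)) Filter.atTop (nhds (Ψ ψ))) :
    toAnti h = Ψ := by
  ext ψ
  refine tendsto_nhds_unique ?_ (hw ψ)
  have : Filter.Tendsto (fun m => inner ℂ (toHil ψ) (toHil (x m))) Filter.atTop
      (nhds (inner ℂ (toHil ψ) h)) := tendsto_const_nhds.inner hx
  simpa only [inner_toHil, toAnti_apply] using this

/-- A regular antifunctional is the limit of elements of `SV` on which creators and annihilators
converge as well. -/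
theorem Reg.exists_seq {Φ : Antidual V} (hΦ : Reg Φ) :
    ∃ φ : ℕ → Sym V,
      (∃ h, toAnti h = Φ ∧ Filter.Tendsto (fun m => toHil (φ m)) Filter.atTop (nhds h)) ∧
      (∀ v, ∃ h, toAnti h = Fock.creat' v Φ ∧
        Filter.Tendsto (fun m => toHil (inc V v * φ m)) Filter.atTop (nhds h)) ∧
      (∀ v, ∃ h, toAnti h = Fock.annih' v Φ ∧
        Filter.Tendsto (fun m => toHil (annih v (φ m))) Filter.atTop (nhds h)) := by
  obtain ⟨t, ht, hk⟩ := hΦ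
  obtain ⟨k, hk⟩ := exists_toAnti_eq hk
  have ht0 : 0 < t := by linarith
  have hr0 : 0 ≤ t⁻¹ := by positivity
  have hr1 : t⁻¹ < 1 := inv_lt_one_of_one_lt₀ ht
  obtain ⟨κ, hκ⟩ : ∃ κ : ℕ → Sym V,
      Filter.Tendsto (fun m => toHil (κ m)) Filter.atTop (nhds k) := by
    obtain ⟨x, hx, hxk⟩ := mem_closure_iff_seq_limit.1 (denseRange_toHil (V := V) k)
    choose κ hκ using hx
    exact ⟨κ, by simpa only [hκ] using hxk⟩
  have hw : ∀ ψ, Filter.Tendsto (fun m => inner ℂ ψ (dil t⁻¹ (κ m))) Filter.atTop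
      (nhds (Φ ψ)) := by
    intro ψ
    have h₁ : Filter.Tendsto (fun m => inner ℂ (toHil (dil t⁻¹ ψ)) (toHil (κ m))) Filter.atTop
      (nhds (inner ℂ (toHil (dil t⁻¹ ψ)) k)) := tendsto_const_nhds.inner hκ
    have h₂ : inner ℂ (toHil (dil t⁻¹ ψ)) k = Φ ψ := by
      rw [← toAnti_apply, hk]
      change Φ (dil t (dil t⁻¹ ψ)) = Φ ψ
      rw [dil_dil, mul_inv_cancel₀ ht0.ne', dil_one]
    rw [h₂] at h₁
    simpa only [inner_toHil, inner_dil] using h₁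
  -- Approximate Φ ∘ t^N and dilate back: composed with t^{-N}, creators and annihilators are
  -- bounded and preserve convergence.
  refine ⟨fun m => dil t⁻¹ (κ m), ?_, fun v => ?_, fun v => ?_⟩
  · obtain ⟨h, hh⟩ := exists_tendsto_of_bound (dil t⁻¹).toLinearMap (exists_bound_dil hr0 hr1) hκ
    exact ⟨h, toAnti_eq_of_tendsto hh hw, hh⟩
  · obtain ⟨h, hh⟩ := exists_tendsto_of_bound (creat v ∘ₗ (dil t⁻¹).toLinearMap)
      (exists_bound_inc_mul_dil v hr0 hr1) hκ
    refine ⟨h, toAnti_eq_of_tendsto hh fun ψ => ?_, hh⟩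
    exact (hw (annih v ψ)).congr fun m => (inner_inc_mul_right v ψ _).symm
  · obtain ⟨h, hh⟩ := exists_tendsto_of_bound ((annih v).toLinearMap ∘ₗ (dil t⁻¹).toLinearMap)
      (exists_bound_annih_dil v hr0 hr1) hκ
    refine ⟨h, toAnti_eq_of_tendsto hh fun ψ => ?_, hh⟩
    exact (hw (inc V v * ψ)).congr fun m => inner_inc_mul_left v ψ _

theorem Reg.mem_fockSpace {Φ : Antidual V} (hΦ : Reg Φ) : Φ ∈ fockSpace V := by
  obtain ⟨φ, ⟨h, rfl, -⟩, -⟩ := hΦ.exists_seq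
  exact toAnti_mem h

/-- Creators and annihilators are mutually adjoint on regular antifunctionals. -/
theorem Reg.inner_creat' {Φ Ψ : Antidual V} (hΦ : Reg Φ) (hΨ : Reg Ψ) (v : V) {x x' y y' : Hil V}
    (hx : toAnti x = Fock.creat' v Φ) (hy : toAnti y = Ψ) (hx' : toAnti x' = Φ)
    (hy' : toAnti y' = Fock.annih' v Ψ) : inner ℂ x y = inner ℂ x' y' := by
  obtain ⟨φ, ⟨p, hp, hp'⟩, hc, -⟩ := hΦ.exists_seq
  obtain ⟨ψ, ⟨q, hq, hq'⟩, -, ha⟩ := hΨ.exists_seq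
  obtain ⟨c, hc, hc'⟩ := hc v
  obtain ⟨a, ha, ha'⟩ := ha v
  obtain rfl := toAnti_injective (hx.trans hc.symm)
  obtain rfl := toAnti_injective (hy.trans hq.symm)
  obtain rfl := toAnti_injective (hx'.trans hp.symm)
  obtain rfl := toAnti_injective (hy'.trans ha.symm)
  refine tendsto_nhds_unique (hc'.inner hq') ((hp'.inner ha').congr fun m => ?_)
  rw [inner_toHil, inner_toHil, inner_inc_mul_left]

/-- A Gaussian with Hilbert-Schmidt exponent of norm less than one is regular. -/
theorem IsGaussianLike.reg {Z : V →ₗ⋆[ℂ] V} (hZ : IsSymmetricAnti Z) {κ h : ℝ}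
    (h0 : 0 ≤ κ) (hκ1 : κ < 1) (hκ : ∀ v, ‖Z v‖ ≤ κ * ‖v‖) (hh : HSBound Z h) {u : Antidual V}
    (h1 : u 1 = 1) (hu : IsGaussianLike Z u) : Reg u := by
  -- Composition with t^N turns the Gaussian of Z into that of t²Z. This choice gives t > 1 and
  -- still t²κ = 2κ/(1 + κ) < 1.
  set t : ℝ := √(2 / (1 + κ)) with ht
  have ht2 : t ^ 2 = 2 / (1 + κ) := Real.sq_sqrt (by positivity)
  have ht1 : 1 < t := by
    rw [ht, Real.lt_sqrt zero_le_one, one_pow, one_lt_div (by positivity)]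
    linarith
  have hn : ∀ v, ‖(((t ^ 2 : ℝ) : ℂ) • Z) v‖ = t ^ 2 * ‖Z v‖ := fun v => by
    rw [LinearMap.smul_apply, norm_smul, Complex.norm_real, Real.norm_of_nonneg (by positivity)]
  refine ⟨t, ht1, IsGaussianLike.mem_fockSpace (Z := ((t ^ 2 : ℝ) : ℂ) • Z) (κ := t ^ 2 * κ)
    (h := (t ^ 2) ^ 2 * h) (fun x y => ?_) (by positivity) ?_ (fun v => ?_)
    (hh.of_norm_le fun v => (hn v).le) ?_ fun v ψ => ?_⟩
  · rw [LinearMap.smul_apply, LinearMap.smul_apply, inner_smul_right, inner_smul_right, hZ]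
  · rw [ht2, div_mul_eq_mul_div, div_lt_one (by positivity)]
    linarith
  · rw [hn, mul_assoc]
    exact mul_le_mul_of_nonneg_left (hκ v) (by positivity)
  · change u (dil t 1) = 1
    rw [map_one, h1]
  · change u (dil t (inc V v * ψ)) = u (dil t (annih ((((t ^ 2 : ℝ) : ℂ) • Z) v) ψ))
    rw [map_mul, dil_inc, smul_mul_assoc, map_smulₛₗ, hu, annih_dil, map_smulₛₗ,
      LinearMap.smul_apply, annih_smul, Derivation.smul_apply, map_smul, map_smulₛₗ]
    simp only [Complex.conj_ofReal, smul_smul]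
    push_cast
    rw [sq]

/-! ### Implementation by antiunitary operators -/

theorem IsWeakMetaplectic.reg {g : V ≃ₗ[ℝ] V} {U : Sym V →ₗ⋆[ℂ] Antidual V}
    (hU : IsWeakMetaplectic g U) (h1 : Reg (U 1)) (φ : Sym V) : Reg (U φ) := by
  induction φ using sym_induction with
  | one => exact h1
  | smul c θ h => rw [map_smulₛₗ]; exact h.smul _
  | add θ η h k => rw [map_add]; exact h.add k
  | cons v θ h =>
    have := hU.2.1 v θ
    rw [creat, LinearMap.mulLeft_apply] at this
    rw [this]
    exact (h.annih' _).add (h.creat' _)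

/-- A weak metaplectic operator with regular vacuum is a multiple of an isometry. -/
theorem IsWeakMetaplectic.exists_isometry {g : V ≃ₗ[ℝ] V} {U : Sym V →ₗ⋆[ℂ] Antidual V}
    (hU : IsWeakMetaplectic g U) (h1 : U 1 ≠ 0) (hr : Reg (U 1)) :
    ∃ (T : Sym V →ₗ⋆[ℂ] Hil V) (N : ℝ), 0 < N ∧ (∀ φ, toAnti (T φ) = U φ) ∧
      ∀ φ, ‖T φ‖ = N * ‖φ‖ := by
  have hreg := hU.reg hr
  let T : Sym V →ₗ⋆[ℂ] Hil V :=
    (fockEquiv (V := V)).symm.toLinearMap.comp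
      (U.codRestrict (fockSpace V) fun φ => (hreg φ).mem_fockSpace)
  have hT : ∀ φ, toAnti (T φ) = U φ := fun φ => by
    rw [← coe_fockEquiv]
    simp [T]
  have hrep : ∀ Φ : Antidual V, Reg Φ → ∃ h, toAnti h = Φ :=
    fun Φ h => exists_toAnti_eq h.mem_fockSpace
  -- The intertwining relations exchange the coefficients C_g v and A_g v between creator and
  -- annihilator, so they are adjoint to each other; order reverses because U is antilinear.
  have step : ∀ v φ ψ, inner ℂ (T (inc V v * φ)) (T ψ) = inner ℂ (T φ) (T (annih v ψ)) := by
    intro v φ ψ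
    obtain ⟨a, ha⟩ := hrep _ ((hreg φ).annih' (linPart g v))
    obtain ⟨c, hc⟩ := hrep _ ((hreg φ).creat' (antiPart g v))
    obtain ⟨a', ha'⟩ := hrep _ ((hreg ψ).annih' (antiPart g v))
    obtain ⟨c', hc'⟩ := hrep _ ((hreg ψ).creat' (linPart g v))
    have e₁ : T (inc V v * φ) = a + c := toAnti_injective (by
      rw [hT, map_add, ha, hc]; exact hU.2.1 v φ)
    have e₂ : T (annih v ψ) = a' + c' := toAnti_injective (by
      rw [hT, map_add, ha', hc']; exact hU.2.2 v ψ)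
    have h₁ := (hreg φ).inner_creat' (hreg ψ) (antiPart g v) hc (hT ψ) (hT φ) ha'
    have h₂ := (hreg ψ).inner_creat' (hreg φ) (linPart g v) hc' (hT φ) (hT ψ) ha
    rw [e₁, e₂, inner_add_left, inner_add_right, h₁, ← inner_conj_symm a, ← h₂, inner_conj_symm,
      add_comm]
  have key : ∀ φ ψ, inner ℂ (T φ) (T ψ) = ((‖T 1‖ ^ 2 : ℝ) : ℂ) * inner ℂ ψ φ := by
    intro φ
    induction φ using sym_induction with
    | one =>
      intro ψ
      induction ψ using sym_induction with
      | one =>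
        rw [inner_self_eq_norm_sq_to_K, inner_self_eq_norm_sq_to_K, norm_one_sym]
        simp
      | smul c θ h => rw [map_smulₛₗ, inner_smul_right, h, inner_smul_left]; ring
      | add θ η h k => rw [map_add, inner_add_right, h, k, inner_add_left]; ring
      | cons v θ h =>
        rw [← inner_conj_symm, step, inner_inc_mul_left, Derivation.map_one_eq_zero, map_zero,
          inner_zero_right, inner_zero_right]
        simp
    | smul c θ h =>
      intro ψ
      rw [map_smulₛₗ, inner_smul_left, h, inner_smul_right, Complex.conj_conj]
      ring
    | add θ η h k =>
      intro ψ
      rw [map_add, inner_add_left, h, k, inner_add_right]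
      ring
    | cons v θ h =>
      intro ψ
      rw [step, h, inner_inc_mul_right]
  refine ⟨T, ‖T 1‖, norm_pos_iff.2 fun h0 => h1 ?_, hT, fun φ => ?_⟩
  · rw [← hT, h0, map_zero]
  · have h := congrArg Complex.re (key φ φ)
    rw [Complex.re_ofReal_mul] at h
    have h₂ : ‖T φ‖ ^ 2 = ‖T 1‖ ^ 2 * ‖φ‖ ^ 2 := by
      rw [← inner_self_eq_norm_sq (𝕜 := ℂ) (T φ), ← inner_self_eq_norm_sq (𝕜 := ℂ) φ]
      exact h
    rw [← mul_pow] at h₂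
    exact (pow_left_inj₀ (norm_nonneg _) (by positivity) two_ne_zero).1 h₂

/-- The annihilator acting on the vacuum drops out, leaving the recursion of the Gaussian of
Z_{g⁻¹}. -/
theorem IsKernelLike.isGaussianLike_apply_one {g : V ≃ₗ[ℝ] V} {U : Sym V →ₗ⋆[ℂ] Antidual V}
    (hU : IsKernelLike g U) : IsGaussianLike (zPart g.symm) (U 1) := fun v ψ => by
  rw [hU.apply_inc_mul, Derivation.map_one_eq_zero, map_zero, LinearMap.zero_apply, zero_add]

theorem IsAntisymplectic.norm_inner_linPart {g : V ≃ₗ[ℝ] V} (hg : IsAntisymplectic g) (x y : V) :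
    ‖inner ℂ x (linPart g y)‖ = ‖inner ℂ y (linPart g.symm x)‖ := by
  rw [norm_inner_symm, hg.inner_linPart, norm_neg]

theorem isHilbertSchmidt_linPart_iff (g : V ≃ₗ[ℝ] V) :
    IsHilbertSchmidt (linPart g) ↔ IsHilbertSchmidt (anticomm g) := by
  rw [anticomm_eq]
  refine ⟨fun h => h.smul _, fun h => ?_⟩
  have := h.smul (2 * Complex.I)⁻¹
  rwa [inv_smul_smul₀ (by simp)] at this

section implement

variable [CompleteSpace V] {g : V ≃ₗ[ℝ] V} {U : Sym V →ₗ⋆[ℂ] Antidual V}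

theorem IsAntisymplectic.hsBound_zPart (hg : IsAntisymplectic g) {h : ℝ}
    (hh : HSBound (linPart g) h) : HSBound (zPart g) (1 ^ 2 * h) :=
  hh.of_norm_le fun v => by
    rw [one_mul, ← hg.antiPart_zPart]
    exact hg.norm_le_norm_antiPart _

theorem IsKernelLike.reg_apply_one (hg : IsAntisymplectic g) (hU : IsKernelLike g U)
    (h1 : U 1 1 = 1) {h : ℝ} (hh : HSBound (linPart g.symm) h) : Reg (U 1) := by
  obtain ⟨κ, h0, hκ1, hκ⟩ := hg.symm.exists_zPart_bound
  exact IsGaussianLike.reg hg.symm.isSymmetricAnti_zPart h0 hκ1 hκ (hg.symm.hsBound_zPart hh) h1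
    hU.isGaussianLike_apply_one

/-- The Hilbert–Schmidt property passes to the adjoint, so the vacuum images of both U and its
transpose are regular. Both are then multiples of isometries, and they are mutually adjoint by
construction. -/
theorem IsKernelLike.exists_isAntiunitary (hg : IsAntisymplectic g) (hU : IsKernelLike g U)
    (h1 : U 1 1 = 1) (hC : IsHilbertSchmidt (linPart g)) :
    ∃ c : ℂ, c ≠ 0 ∧ IsAntiunitary (c • U) := by
  have hadj : ∀ x y, ‖inner ℂ x (linPart g.symm y)‖ = ‖inner ℂ y (linPart g x)‖ :=
    fun x y => (hg.norm_inner_linPart y x).symm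
  obtain ⟨h, hh⟩ := hC.exists_hsBound_adjoint hadj
  have hh' : HSBound (linPart g.symm.symm) h := by
    rw [LinearEquiv.symm_symm]; exact hh.adjoint hg.norm_inner_linPart
  have ne : ∀ {U : Sym V →ₗ⋆[ℂ] Antidual V}, U 1 1 = 1 → U 1 ≠ 0 := fun h h0 => by
    simp [h0] at h
  have h1' : U.flip 1 1 = 1 := h1
  obtain ⟨T, N, hN, hT, hTn⟩ := (hU.isWeakMetaplectic hg h1).exists_isometry (ne h1)
    (hU.reg_apply_one hg h1 hh)
  obtain ⟨T', N', hN', hT', hTn'⟩ := (hU.flip.isWeakMetaplectic hg.symm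
    h1').exists_isometry (ne h1')
    (hU.flip.reg_apply_one hg.symm h1' hh')
  refine Fock.exists_isAntiunitary hN hN' hTn hTn' (fun φ ψ => ?_) hT
  rw [← toAnti_apply, ← toAnti_apply, hT, hT', LinearMap.flip_apply]

/-- Of antiunitarity only one consequence is needed: the Gaussian U(1) lies in Fock space. Hence
Z_{g⁻¹} is Hilbert–Schmidt, then C_{g⁻¹} = A_{g⁻¹}Z_{g⁻¹}, then its adjoint up to sign. -/
theorem IsKernelLike.isHilbertSchmidt (hg : IsAntisymplectic g) (hU : IsKernelLike g U)
    (h1 : U 1 1 = 1) {c : ℂ} (hc : c ≠ 0) (ha : IsAntiunitary (c • U)) :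
    IsHilbertSchmidt (linPart g) := by
  have hmem : U 1 ∈ fockSpace V := by
    have := Submodule.smul_mem _ c⁻¹ (ha.mem_fockSpace 1)
    rwa [LinearMap.smul_apply, inv_smul_smul₀ hc] at this
  obtain ⟨M, hM⟩ := hmem
  have hZ := IsGaussianLike.hsBound hg.symm.isSymmetricAnti_zPart h1 hU.isGaussianLike_apply_one hM
  obtain ⟨K, -, hK⟩ := hg.symm.exists_antiPart_bound
  have hC := hZ.of_norm_le (S := linPart g.symm) fun v => by
    rw [← hg.symm.antiPart_zPart]; exact hK _
  obtain ⟨L, -, hL⟩ := hg.exists_antiPart_bound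
  refine (hC.adjoint hg.norm_inner_linPart).isHilbertSchmidt ?_
  exact (AddMonoidHomClass.lipschitz_of_bound (linPart g) L fun v =>
    (hg.norm_linPart_le v).trans (hL v)).continuous

end implement

end Fock

end

/-! ### Assembly of the theorem -/

open Fock in
theorem mainTheorem10 {V : Type*} [NormedAddCommGroup V] [InnerProductSpace ℂ V] [CompleteSpace V]
    (g : V ≃ₗ[ℝ] V) (hg : IsAntisymplectic g) :
    -- `A_g` and `A_{g⁻¹}` are invertible; `Z_g` is symmetric with operator norm less than one
    (Function.Bijective (antiPart g) ∧ Function.Bijective (antiPart g.symm)) ∧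
    (IsSymmetricAnti (zPart g) ∧ ∃ k : ℝ, 0 ≤ k ∧ k < 1 ∧ ∀ v, ‖zPart g v‖ ≤ k * ‖v‖) ∧
    ∃ u : Antidual (Double V),
      -- `u = e^Z` is the kernel of a weak metaplectic operator `U_g` implementing `g`
      IsGaussian (kernelZ g) u ∧ IsWeakMetaplectic g (kernelOp u) ∧
      -- uniqueness up to scale
      (∀ U : Sym V →ₗ⋆[ℂ] Antidual V, IsWeakMetaplectic g U →
        ∃ c : ℂ, c ≠ 0 ∧ U = c • kernelOp u) ∧
      -- `U_g` can be rescaled to an antiunitary precisely when `C_g` is Hilbert-Schmidt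
      ((∃ c : ℂ, c ≠ 0 ∧ IsAntiunitary (c • kernelOp u)) ↔ IsHilbertSchmidt (linPart g)) ∧
      -- `g` is implemented by an antiunitary precisely when `[g, i]₊` is Hilbert-Schmidt
      ((∃ U : Sym V →ₗ⋆[ℂ] Antidual V, IsWeakMetaplectic g U ∧ IsAntiunitary U) ↔
        IsHilbertSchmidt (anticomm g)) ∧
      (IsHilbertSchmidt (linPart g) ↔ IsHilbertSchmidt (anticomm g)) := by
  obtain ⟨u, h1, hu⟩ := exists_isGaussianLike hg.isSymmetricAnti_kernelZ
  have hK := hu.isKernelLike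
  have hK1 : kernelOp u 1 1 = 1 := by simp [kernelOp_apply, h1]
  have hU := hK.isWeakMetaplectic hg hK1
  have hiff : (∃ c : ℂ, c ≠ 0 ∧ IsAntiunitary (c • kernelOp u)) ↔ IsHilbertSchmidt (linPart g) :=
    ⟨fun ⟨_, hc, h⟩ => hK.isHilbertSchmidt hg hK1 hc h, hK.exists_isAntiunitary hg hK1⟩
  refine ⟨⟨hg.bijective_antiPart, hg.symm.bijective_antiPart⟩,
    ⟨hg.isSymmetricAnti_zPart, hg.exists_zPart_bound⟩, u, hu.isGaussian h1, hU,
    fun U h => hg.exists_smul_eq h hU hK1, hiff, ?_, isHilbertSchmidt_linPart_iff g⟩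
  rw [← isHilbertSchmidt_linPart_iff, ← hiff]
  constructor
  · rintro ⟨U, h, ha⟩
    obtain ⟨c, hc, rfl⟩ := hg.exists_smul_eq h hU hK1
    exact ⟨c, hc, ha⟩
  · rintro ⟨c, hc, ha⟩
    exact ⟨_, hU.smul hc, ha⟩
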